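/- **Setting.** Let $K\ge 1$, let $\mathcal S_1,\dots,\mathcal S_K\subseteq\mathbb R$ be nonempty closed sets, and let $P>0$. *Channel.* For every number $M\in\mathbb N$ of channel uses, a channel $Y(m)=\sum_{k=1}^K H_k(m)x_k(m)+N(m)$, $m=1,\dots,M$, is given, with complex inputs subject to $|x_k(m)|^2\le P$. Let $H\in\mathbb R^{2KM}$ be the vector of the real and imaginary parts of all $H_k(m)$ and $N\in\mathbb R^{2M}$ that of the real and imaginary parts of all $N(m)$. There are matrices $A=A_M\in\mathbb R^{2KM\times(2KM+2M)}$ and $B=B_M\in\mathbb R^{2M\times(2KM+2M)}$ and a vector $R$ of $2KM+2M$ independent real random variables with sub-Gaussian norm at most $1$ such that $H=AR$ and $N=BR$; the entries of $H$ have mean $0$ and variance $1$, and those of $N$ have mean $0$. (The sub-Gaussian norm of $X$ is the infimum of all $t>0$ with $\mathbb E\exp(\lambda(X-\mathbb EX))\le\exp(\lambda^2t^2/2)$ for all $\lambda\in\mathbb R$.) Let $A_i=A_{i,M}$ be a matrix of the size of $A$ that generates user-uncorrelated fading, i.e. in the fading vector $A_iR$ the coefficients of any two different users at the same channel use and in the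 same (real or imaginary) dimension are independent, and let $\eta=\eta_M$ be a number with $\|(A+A_i)(A-A_i)^{T}\|_{\mathrm{op}}\le\eta$. *Communication cost.* A scheme with $M$ channel uses consists of measurable encoders, where transmitter $k$ sends $x_k(m)=E_k(m,s_k,U_k(m))$ with $|x_k(m)|^2\le P$ and with random variables $U_k(1),\dots,U_k(M)$, the randomness of different transmitters and the channel being independent, and of a measurable decoder $D^M:\mathbb C^M\to\mathbb R$; the estimate is $\tilde f=D^M(Y(1),\dots,Y(M))$. For $f:\mathcal S_1\times\dots\times\mathcal S_K\to\mathbb R$, $\varepsilon>0$ and $\delta\in(0,1)$, the communication cost $M(f,\varepsilon,\delta)$ is the smallest $M\in\{0,1,2,\dots\}$ for which there is a scheme with $M$ channel uses such that $\mathbb P(|\tilde f-f(s_1,\dots,s_K)|\ge\varepsilon)\le\delta$ for all $(s_1,\dots,s_K)$. *Function.* Let $f(s_1,\dots,s_K)=F\big(\sum_{k=1}^K f_k(s_k)\big)$ with bounded measurable $f_k:\mathcal S_k\to\mathbb R$ and measurable $F:D_F\to\mathbb R$ on a measurable set $D_F\supseteq f_1(\mathcal S_1)+\dots+f_K(\mathcal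 S_K)$, and let $\Phi:[0,\infty)\to[0,\infty)$ be strictly increasing with $\Phi(0)=0$ and $|F(x)-F(y)|\le\Phi(|x-y|)$ for all $x,y\in D_F$. Put $$\bar\Delta=\sum_{k=1}^K\big(\sup f_k-\inf f_k\big),\qquad \Delta=\max_{1\le k\le K}\big(\sup f_k-\inf f_k\big).$$ Let $\delta\in(0,1)$, and let $\varepsilon>0$ lie in the range of $\Phi$, so that $\Phi^{-1}(\varepsilon)>0$ is defined. For $M\ge1$ put, with $\|\cdot\|_{\mathrm{op}}$ the operator norm and $\|\cdot\|_{\mathrm F}$ the Frobenius norm, $$\mathcal L_M=\Big(\sqrt{\bar\Delta}\,\|A\|_{\mathrm{op}}+\sqrt{\tfrac{\Delta}{P}}\,\|B\|_{\mathrm{op}}\Big)^2,\qquad \mathcal F_M=\mathcal L_M\Big(\sqrt{\tfrac{\bar\Delta}{M}}\,\|A\|_{\mathrm F}+\sqrt{\tfrac{\Delta}{PM}}\,\|B\|_{\mathrm F}\Big)^2,$$ $$\mathcal D_M=\Big(4\sqrt{2M}\,\bar\Delta\,\eta+4\tfrac{\Delta}{\sqrt{PM}}\,\|AB^{T}\|_{\mathrm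 F}\Big)^2,$$ $$\Gamma_M=\max\big(16\mathcal F_M+\mathcal D_M+4\Phi^{-1}(\varepsilon)\mathcal L_M,\;256\mathcal F_M+32\Phi^{-1}(\varepsilon)\mathcal L_M\big).$$ **Claim.** 1. For every $M\ge1$ with $M\ge\dfrac{\log4-\log\delta}{\Phi^{-1}(\varepsilon)^2}\,\Gamma_M$ we have $M(f,\varepsilon,\delta)\le M$. 2. If $\Gamma$ is a real number with $\Gamma_M\le\Gamma$ for all $M\ge1$ (in particular, if $\Gamma_M=\Gamma$ does not depend on $M$), then $$M(f,\varepsilon,\delta)\le\frac{\log4-\log\delta}{\Phi^{-1}(\varepsilon)^2}\,\Gamma .$$ -/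

import Mathlib

open MeasureTheory ProbabilityTheory
open scoped NNReal ENNReal

universe u

noncomputable section

namespace OTA

/-! ### Sub-Gaussian norm and matrix norms -/

/-- The sub-Gaussian norm of a real random variable: the infimum of all `t > 0` such that
`E exp (l (X - E X)) ≤ exp (l² t² / 2)` for all real `l`; it is `∞` if there is no such `t`.
(`HasSubgaussianMGF` also says that the exponentials are integrable, so that the inequality is
about true expectations.) -/
def subGaussianNorm {Ω : Type*} [MeasurableSpace Ω] (X : Ω → ℝ) (μ : Measure Ω) : ℝ≥0∞ :=
  ⨅ (t : ℝ≥0) (_ : 0 < t)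
    (_ : HasSubgaussianMGF (fun ω => X ω - ∫ ω', X ω' ∂μ) (t ^ 2) μ), (t : ℝ≥0∞)

/-- The operator norm of a real matrix with respect to the Euclidean norms. -/
def opNorm {m n : Type*} [Fintype m] [Fintype n] [DecidableEq n] (A : Matrix m n ℝ) : ℝ :=
  ‖LinearMap.toContinuousLinearMap (Matrix.toEuclideanLin A)‖

/-- The Frobenius norm of a real matrix. -/
def frobNorm {m n : Type*} [Fintype m] [Fintype n] (A : Matrix m n ℝ) : ℝ :=
  Real.sqrt (∑ i, ∑ j, A i j ^ 2)

/-! ### The channel -/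

/-- Index set of the `2KM` real fading coefficients: channel use, complex dimension
(`0` for the real part and `1` for the imaginary part), user. -/
abbrev FadingIdx (K M : ℕ) : Type := Fin M × Fin 2 × Fin K

/-- Index set of the `2M` real noise coefficients: channel use, complex dimension. -/
abbrev NoiseIdx (M : ℕ) : Type := Fin M × Fin 2

/-- Index set of the `2KM + 2M` independent random variables that drive fading and noise. -/
abbrev SourceIdx (K M : ℕ) : Type := Fin (2 * K * M + 2 * M)

/-- The real random vector `A R`. -/
def linImage {ι κ Ω : Type*} [Fintype κ] (A : Matrix ι κ ℝ) (R : κ → Ω → ℝ) (i : ι) (ω : Ω) : ℝ :=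
  ∑ j, A i j * R j ω

/-- A fast-fading multiple-access channel with `K` transmitters and `M` channel uses. The vector
of the real and imaginary parts of all fading coefficients is `A R`, and that of the additive
noise is `B R`, where the entries of `R` are independent with sub-Gaussian norm at most `1`. The
fading coefficients have mean zero and variance one, the noise coefficients have mean zero. -/
structure Channel (K M : ℕ) : Type (u + 1) where
  Ω : Type u
  [measurableSpace : MeasurableSpace Ω]
  μ : Measure Ω
  [isProbabilityMeasure : IsProbabilityMeasure μ]
  R : SourceIdx K M → Ω → ℝ
  measurable_R : ∀ i, Measurable (R i)
  indep_R : iIndepFun R μ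
  subGaussian_R : ∀ i, subGaussianNorm (R i) μ ≤ 1
  A : Matrix (FadingIdx K M) (SourceIdx K M) ℝ
  B : Matrix (NoiseIdx M) (SourceIdx K M) ℝ
  fading_mean : ∀ i, ∫ ω, linImage A R i ω ∂μ = 0
  fading_variance : ∀ i, variance (linImage A R i) μ = 1
  noise_mean : ∀ i, ∫ ω, linImage B R i ω ∂μ = 0

attribute [instance] Channel.measurableSpace Channel.isProbabilityMeasure

namespace Channel

variable {K M : ℕ} (C : Channel.{u} K M)

/-- The complex fading coefficient `H_k(m)`. -/
def H (k : Fin K) (m : Fin M) (ω : C.Ω) : ℂ :=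
  ⟨linImage C.A C.R (m, 0, k) ω, linImage C.A C.R (m, 1, k) ω⟩

/-- The complex additive noise `N(m)`. -/
def N (m : Fin M) (ω : C.Ω) : ℂ :=
  ⟨linImage C.B C.R (m, 0) ω, linImage C.B C.R (m, 1) ω⟩

/-- The channel output `Y(m) = ∑ k, H_k(m) x_k(m) + N(m)` for the transmit symbols `x`. -/
def output (x : Fin K → Fin M → ℂ) (ω : C.Ω) (m : Fin M) : ℂ :=
  ∑ k, C.H k m ω * x k m + C.N m ω

/-- The matrix `A'` generates user-uncorrelated fading: in the fading vector `A' R`, the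
coefficients of two different users at the same channel use and in the same complex dimension
are independent. -/
def GeneratesUserUncorrelated (A' : Matrix (FadingIdx K M) (SourceIdx K M) ℝ) : Prop :=
  ∀ (m : Fin M) (j : Fin 2) (k₁ k₂ : Fin K), k₁ ≠ k₂ →
    IndepFun (linImage A' C.R (m, j, k₁)) (linImage A' C.R (m, j, k₂)) C.μ

end Channel

/-! ### Distributed function approximation schemes -/

/-- An admissible scheme with `M` channel uses and peak power `P`. Transmitter `k` sends
`enc k m (s_k) (U_k(m))` at channel use `m`. The vector `(U_k(1), …, U_k(M))` of its random
variables has the law `law k`; the transmitters randomize independently of each other (and of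
the channel, see `errorProb`). -/
structure Scheme {K : ℕ} (S : Fin K → Set ℝ) (P : ℝ) (M : ℕ) where
  T : Fin K → Fin M → Type
  [measurableSpace : ∀ k m, MeasurableSpace (T k m)]
  law : ∀ k, Measure (∀ m, T k m)
  [isProbabilityMeasure : ∀ k, IsProbabilityMeasure (law k)]
  enc : ∀ (k : Fin K) (m : Fin M), S k → T k m → ℂ
  measurable_enc : ∀ k, Measurable fun p : S k × (∀ m, T k m) => fun m => enc k m p.1 (p.2 m)
  power : ∀ k m s t, ‖enc k m s t‖ ^ 2 ≤ P
  dec : (Fin M → ℂ) → ℝ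
  measurable_dec : Measurable dec

attribute [instance] Scheme.measurableSpace Scheme.isProbabilityMeasure

section Approximation

variable {K : ℕ} {S : Fin K → Set ℝ} {P : ℝ}

/-- The estimate of `f (s_1, …, s_K)` as a function of the channel state `ω` and of the random
variables `u` of the transmitters. -/
def Scheme.estimate {M : ℕ} (E : Scheme S P M) (C : Channel.{u} K M) (s : ∀ k, S k)
    (ω : C.Ω) (u : ∀ k m, E.T k m) : ℝ :=
  E.dec (C.output (fun k m => E.enc k m (s k) (u k m)) ω)

/-- The probability that the estimate is off by at least `ε` for the input `s`. -/
def Scheme.errorProb {M : ℕ} (E : Scheme S P M) (C : Channel.{u} K M) (f : (∀ k, S k) → ℝ)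
    (ε : ℝ) (s : ∀ k, S k) : ℝ≥0∞ :=
  (C.μ.prod (Measure.pi E.law)) {p | ε ≤ |E.estimate C s p.1 p.2 - f s|}

/-- `f` is `ε`-approximated after `M` channel uses with confidence level `δ`. -/
def IsApproximated {M : ℕ} (C : Channel.{u} K M) (P : ℝ) (f : (∀ k, S k) → ℝ) (ε δ : ℝ) : Prop :=
  ∃ E : Scheme S P M, ∀ s, E.errorProb C f ε s ≤ ENNReal.ofReal δ

/-- The communication cost `M(f, ε, δ)`: the smallest number of channel uses after which `f` is
`ε`-approximated with confidence level `δ` (`∞` if there is none), where `C M` is the channel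
with `M` uses. -/
def commCost (C : ∀ M, Channel.{u} K M) (P : ℝ) (f : (∀ k, S k) → ℝ) (ε δ : ℝ) : ℕ∞ :=
  ⨅ (M : ℕ) (_ : IsApproximated (C M) P f ε δ), (M : ℕ∞)

end Approximation

/-! ### The class of functions and its spreads -/

/-- A representation `f(s_1, …, s_K) = F(∑ k, f_k(s_k))` with bounded measurable `f_k`, a
measurable `F` on a measurable set `D`, and an increment majorant `Φ`. A function belongs to the
class `F_mon` iff it has such a representation. -/
structure MonRep {K : ℕ} {S : Fin K → Set ℝ} (f : (∀ k, S k) → ℝ) where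
  inner : ∀ k, S k → ℝ
  measurable_inner : ∀ k, Measurable (inner k)
  bounded_inner : ∀ k, ∃ b, ∀ s, |inner k s| ≤ b
  D : Set ℝ
  measurableSet_D : MeasurableSet D
  sum_mem : ∀ s : ∀ k, S k, ∑ k, inner k (s k) ∈ D
  F : D → ℝ
  measurable_F : Measurable F
  eq : ∀ s : ∀ k, S k, f s = F ⟨∑ k, inner k (s k), sum_mem s⟩
  /-- The increment majorant, used on `[0, ∞)` only; it maps `[0, ∞)` to `[0, ∞)` because it is
  increasing there and vanishes at `0`. -/
  Φ : ℝ → ℝ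
  strictMono_Φ : StrictMonoOn Φ (Set.Ici 0)
  Φ_zero : Φ 0 = 0
  majorant : ∀ x y : D, |F x - F y| ≤ Φ |(x : ℝ) - y|

namespace MonRep

variable {K M : ℕ} {S : Fin K → Set ℝ} {f : (∀ k, S k) → ℝ} (r : MonRep f)

/-- `φ_max,k - φ_min,k`. -/
def spread (k : Fin K) : ℝ := (⨆ s, r.inner k s) - ⨅ s, r.inner k s

/-- The total spread of the inner part. -/
def totalSpread : ℝ := ∑ k, r.spread k

/-- The max-spread of the inner part. -/
def maxSpread : ℝ := ⨆ k, r.spread k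

/-- `Φ⁻¹(ε)`, for `ε` in the range of `Φ`. -/
def ΦInv (ε : ℝ) : ℝ := Function.invFunOn r.Φ (Set.Ici 0) ε

/-- The quantity `L`. -/
def boundL (C : Channel.{u} K M) (P : ℝ) : ℝ :=
  (Real.sqrt r.totalSpread * opNorm C.A + Real.sqrt (r.maxSpread / P) * opNorm C.B) ^ 2

/-- The quantity `F`. -/
def boundF (C : Channel.{u} K M) (P : ℝ) : ℝ :=
  r.boundL C P *
    (Real.sqrt (r.totalSpread / M) * frobNorm C.A
      + Real.sqrt (r.maxSpread / (P * M)) * frobNorm C.B) ^ 2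

/-- The quantity `D`. -/
def boundD (C : Channel.{u} K M) (P η : ℝ) : ℝ :=
  (4 * Real.sqrt (2 * M) * r.totalSpread * η
    + 4 * (r.maxSpread / Real.sqrt (P * M)) * frobNorm (C.A * C.B.transpose)) ^ 2

/-- The quantity `Γ`, for `M` channel uses. -/
def Gam (C : Channel.{u} K M) (P η ε : ℝ) : ℝ :=
  max (16 * r.boundF C P + r.boundD C P η + 4 * r.ΦInv ε * r.boundL C P)
    (256 * r.boundF C P + 32 * r.ΦInv ε * r.boundL C P)

end MonRep

end OTA

end

/-!
Every transmitter `k` sends an amplitude whose square is proportional to `f_k(s_k) - inf f_k`,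
with a fair random sign that is fresh in every channel use. Signs are orthonormal and the fading
coefficients have variance one, so the mean of the received energy `∑ |Y(m)|²` is an affine
function of `∑ f_k(s_k)`, whatever the correlations of fading and noise. The receiver inverts this
function, moves the result to a nearby point of the domain of `F`, and applies `F`. If the inner
estimate is within `t / 2` of the inner sum, where `t = Φ⁻¹(ε)`, the point found is within `t` of
it, and the majorant `Φ` gives an error below `ε`.

It remains to bound the deviations of the energy, through its moment generating function. Given
the signs, the energy is `‖W X‖²` for a matrix `W` with explicit bounds for its norms and a vector
`X` of independent centered sub-Gaussian variables, and `lintegral_exp_quad_le` is a Hanson–Wright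
bound with explicit constants. It is proved by integrating out one coordinate at a time: this
replaces the quadratic form by one in fewer variables, like a Schur complement, and a bound for
the operator norm survives. The conditional mean given the signs is a sum of independent bounded
terms, so Hoeffding's lemma applies (`lintegral_exp_condMean_le`). Together the exponent is at
most `43 λ² ‖W‖_op² ‖W‖_F²` for small `λ` (`lintegral_exp_energy_le`).

The part `256 F + 32 t L` of `Gam` is enough for this. If `t` exceeds the total spread of the
inner sum, a constant estimate works without any channel use. Otherwise the Chernoff exponent is
quadratic, and `200 F` in place of `256 F` suffices. The bound in the second claim is then at
least `16`, so its integer part is a number of channel uses for which the scheme still works.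
-/

/-! ### Squares of sub-Gaussian variables -/

namespace OTA

section OneVariable

/-- Completing the square: `exp (3 x² / 8)` is a Gaussian mixture of the
exponentials `exp (y x)`. -/
theorem lintegral_exp_complete_square (x : ℝ) :
    ∫⁻ y : ℝ, ENNReal.ofReal (Real.exp (y * x - 2 / 3 * y ^ 2)) =
      ENNReal.ofReal (Real.sqrt (Real.pi / (2 / 3)) * Real.exp (3 / 8 * x ^ 2)) := by
  have h : ∀ y : ℝ, Real.exp (y * x - 2 / 3 * y ^ 2) =
      Real.exp (3 / 8 * x ^ 2) * Real.exp (-(2 / 3) * (y - 3 / 4 * x) ^ 2) := fun y => by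
    rw [← Real.exp_add]; congr 1; ring
  have hint : Integrable fun y : ℝ => Real.exp (y * x - 2 / 3 * y ^ 2) := by
    simp_rw [h]
    exact ((integrable_exp_neg_mul_sq (by norm_num : (0 : ℝ) < 2 / 3)).comp_sub_right _).const_mul _
  rw [← ofReal_integral_eq_lintegral_ofReal hint (ae_of_all _ fun y => (Real.exp_pos _).le)]
  simp_rw [h]
  rw [integral_const_mul, integral_sub_right_eq_self (fun y => Real.exp (-(2 / 3) * y ^ 2)),
    integral_gaussian, mul_comm]

variable {Ω : Type*} [MeasurableSpace Ω] {μ : Measure Ω} {X : Ω → ℝ}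

theorem integrable_sq (hX : HasSubgaussianMGF X 1 μ) : Integrable (fun ω => X ω ^ 2) μ := by
  simpa using (hX.memLp 2).integrable_sq

variable [IsProbabilityMeasure μ]

/-- A sub-Gaussian variable is square-exponentially integrable: average the bound for its moment
generating function at `y` over a Gaussian `y`. -/
theorem lintegral_exp_sq_le (hX : HasSubgaussianMGF X 1 μ) (hm : Measurable X) :
    ∫⁻ ω, ENNReal.ofReal (Real.exp (3 / 8 * X ω ^ 2)) ∂μ ≤ 2 := by
  have hc : 0 < Real.sqrt (Real.pi / (2 / 3)) := Real.sqrt_pos.2 (by positivity)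
  have key : ∫⁻ ω, ENNReal.ofReal (Real.sqrt (Real.pi / (2 / 3)) * Real.exp (3 / 8 * X ω ^ 2)) ∂μ
      ≤ ENNReal.ofReal (Real.sqrt (Real.pi / (2 / 3)) * 2) := by
    simp_rw [← lintegral_exp_complete_square]
    rw [lintegral_lintegral_swap (by fun_prop)]
    calc ∫⁻ y : ℝ, ∫⁻ ω, ENNReal.ofReal (Real.exp (y * X ω - 2 / 3 * y ^ 2)) ∂μ
        ≤ ∫⁻ y : ℝ, ENNReal.ofReal (Real.exp (-(1 / 6) * y ^ 2)) := by
          refine lintegral_mono fun y => ?_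
          have h : ∀ ω, Real.exp (y * X ω - 2 / 3 * y ^ 2) =
              Real.exp (y * X ω) * Real.exp (-(2 / 3) * y ^ 2) := fun ω => by
            rw [← Real.exp_add]; congr 1; ring
          simp_rw [h]
          rw [← ofReal_integral_eq_lintegral_ofReal ((hX.integrable_exp_mul y).mul_const _)
            (ae_of_all _ fun y => by positivity), integral_mul_const]
          refine ENNReal.ofReal_le_ofReal ?_
          calc _ ≤ Real.exp (((1 : ℝ≥0) : ℝ) * y ^ 2 / 2) * Real.exp (-(2 / 3) * y ^ 2) :=
                mul_le_mul_of_nonneg_right (hX.mgf_le y) (Real.exp_pos _).le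
            _ = _ := by rw [← Real.exp_add]; congr 1; push_cast; ring
      _ = ENNReal.ofReal (Real.sqrt (Real.pi / (1 / 6))) := by
          rw [← ofReal_integral_eq_lintegral_ofReal
            (integrable_exp_neg_mul_sq (by norm_num)) (ae_of_all _ fun y => (Real.exp_pos _).le),
            integral_gaussian]
      _ = _ := by
          congr 1
          rw [show Real.pi / (1 / 6) = Real.pi / (2 / 3) * 2 ^ 2 by ring,
            Real.sqrt_mul (by positivity), Real.sqrt_sq (by norm_num)]
  simp_rw [ENNReal.ofReal_mul hc.le] at key
  rw [lintegral_const_mul _ (by fun_prop)] at key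
  have := (ENNReal.mul_le_mul_iff_right (by simpa using hc) ENNReal.ofReal_ne_top).1 key
  simpa using this

theorem integrable_exp_sq (hX : HasSubgaussianMGF X 1 μ) (hm : Measurable X) :
    Integrable (fun ω => Real.exp (3 / 8 * X ω ^ 2)) μ := by
  refine ⟨by fun_prop, ?_⟩
  rw [hasFiniteIntegral_iff_ofReal (ae_of_all _ fun y => (Real.exp_pos _).le)]
  exact (lintegral_exp_sq_le hX hm).trans_lt (by simp)

theorem integral_exp_sq_le (hX : HasSubgaussianMGF X 1 μ) (hm : Measurable X) :
    ∫ ω, Real.exp (3 / 8 * X ω ^ 2) ∂μ ≤ 2 := by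
  have := lintegral_exp_sq_le hX hm
  rw [← ofReal_integral_eq_lintegral_ofReal (integrable_exp_sq hX hm)
    (ae_of_all _ fun y => (Real.exp_pos _).le)] at this
  rwa [ENNReal.ofReal_le_iff_le_toReal (by simp)] at this

theorem integral_sq_le (hX : HasSubgaussianMGF X 1 μ) (hm : Measurable X) :
    ∫ ω, X ω ^ 2 ∂μ ≤ 2 := by
  -- the tangent to `exp` at `1 / 2`, close to the optimal point `log 2`
  have h : ∀ x : ℝ, 1.625 * (1 / 2 + 3 / 8 * x ^ 2) ≤ Real.exp (3 / 8 * x ^ 2) := fun x => by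
    have h1 := Real.quadratic_le_exp_of_nonneg (x := 1 / 2) (by norm_num)
    have h2 := Real.add_one_le_exp (3 / 8 * x ^ 2 - 1 / 2)
    have h3 : Real.exp (3 / 8 * x ^ 2) = Real.exp (1 / 2) * Real.exp (3 / 8 * x ^ 2 - 1 / 2) := by
      rw [← Real.exp_add]; congr 1; ring
    rw [h3]
    exact mul_le_mul (by norm_num at h1 ⊢; linarith) (by linarith) (by positivity)
      (Real.exp_pos _).le
  have hi : Integrable (fun ω => 3 / 8 * X ω ^ 2) μ := (integrable_sq hX).const_mul _
  have hi' : Integrable (fun ω => 1.625 * (1 / 2 + 3 / 8 * X ω ^ 2)) μ :=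
    ((integrable_const _).add hi).const_mul _
  have h3 := integral_mono hi' (integrable_exp_sq hX hm) fun ω => h (X ω)
  rw [integral_const_mul, integral_add (integrable_const _) hi,
    integral_const_mul] at h3
  have h4 := integral_exp_sq_le hX hm
  simp only [integral_const, smul_eq_mul, probReal_univ, one_mul] at h3
  norm_num at h3
  linarith

theorem abs_exp_sub_one_sub_le (y : ℝ) : |Real.exp y - 1 - y| ≤ y ^ 2 * Real.exp |y| := by
  have := Complex.norm_exp_sub_sum_le_norm_mul_exp (y : ℂ) 2
  simp only [Finset.sum_range_succ, Finset.range_zero, Finset.sum_empty] at this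
  norm_num at this
  rw [← Complex.ofReal_exp, ← Complex.ofReal_one, ← Complex.ofReal_add, ← Complex.ofReal_sub,
    Complex.norm_real, Real.norm_eq_abs, ← sub_sub] at this
  exact this

/-- Second-order expansion of `exp` at `θ (x² - v)`; the remainder is absorbed by
`exp (3 x² / 8)`. -/
theorem exp_mul_sq_sub_le {θ v : ℝ} (hθ : |θ| ≤ 1 / 32) (hv0 : 0 ≤ v) (hv : v ≤ 2) (x : ℝ) :
    Real.exp (θ * (x ^ 2 - v)) ≤
      1 + θ * (x ^ 2 - v) + 10.5 * θ ^ 2 * Real.exp (3 / 8 * x ^ 2) := by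
  set y := θ * (x ^ 2 - v)
  have h1 := (abs_le.1 (abs_exp_sub_one_sub_le y)).2
  have hz : |x ^ 2 - v| ≤ x ^ 2 + 2 := by rw [abs_le]; constructor <;> nlinarith [sq_nonneg x]
  have hy : |y| ≤ 1 / 32 * (x ^ 2 + 2) := by
    rw [abs_mul]; exact mul_le_mul hθ hz (abs_nonneg _) (by norm_num)
  have hw : (x ^ 2 + 2) ^ 2 ≤ 36 * Real.exp ((x ^ 2 + 2) / 3 - 2) := by
    have h2 := Real.add_one_le_exp ((x ^ 2 + 2) / 6 - 1)
    have h3 : Real.exp ((x ^ 2 + 2) / 3 - 2) = Real.exp ((x ^ 2 + 2) / 6 - 1) ^ 2 := by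
      rw [← Real.exp_nat_mul]; congr 1; push_cast; ring
    rw [h3]; nlinarith [sq_nonneg x]
  -- `36 exp (-5 / 4)` is the constant left after comparing the exponents below
  have h5 : Real.exp (5 / 4) ≥ 36 / 10.5 := by
    have h6 := Real.quadratic_le_exp_of_nonneg (x := 5 / 16) (by norm_num)
    have h7 : Real.exp (5 / 4) = Real.exp (5 / 16) ^ 4 := by
      rw [← Real.exp_nat_mul]; congr 1; norm_num
    rw [h7]
    have : (1 + 5 / 16 + (5 / 16) ^ 2 / 2 : ℝ) ^ 4 ≤ Real.exp (5 / 16) ^ 4 :=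
      pow_le_pow_left₀ (by norm_num) h6 4
    norm_num at this ⊢
    linarith
  have h8 : y ^ 2 * Real.exp |y| ≤ 10.5 * θ ^ 2 * Real.exp (3 / 8 * x ^ 2) := by
    calc y ^ 2 * Real.exp |y|
        ≤ (θ ^ 2 * (36 * Real.exp ((x ^ 2 + 2) / 3 - 2))) * Real.exp (1 / 32 * (x ^ 2 + 2)) := by
          refine mul_le_mul ?_ (Real.exp_le_exp.2 hy) (Real.exp_pos _).le (by positivity)
          rw [mul_pow]
          refine mul_le_mul_of_nonneg_left (le_trans ?_ hw) (sq_nonneg _)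
          exact sq_le_sq' (by linarith [(abs_le.1 hz).1]) (abs_le.1 hz).2
      _ = 36 * θ ^ 2 * Real.exp (35 / 96 * x ^ 2 - 61 / 48) := by
          rw [mul_assoc, mul_assoc, ← Real.exp_add, mul_left_comm, ← mul_assoc]; congr 2; ring
      _ ≤ 36 * θ ^ 2 * Real.exp (3 / 8 * x ^ 2 - 5 / 4) := by
          gcongr ?_ * Real.exp ?_
          nlinarith [sq_nonneg x]
      _ = 36 * θ ^ 2 * (Real.exp (3 / 8 * x ^ 2) / Real.exp (5 / 4)) := by rw [Real.exp_sub]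
      _ ≤ _ := by
          have h9 : Real.exp (3 / 8 * x ^ 2) / Real.exp (5 / 4) ≤
              Real.exp (3 / 8 * x ^ 2) / (36 / 10.5) := by gcongr
          have := mul_le_mul_of_nonneg_left h9 (by positivity : 0 ≤ 36 * θ ^ 2)
          refine this.trans (le_of_eq ?_)
          ring
  linarith

theorem lintegral_exp_mul_sq_sub_le (hX : HasSubgaussianMGF X 1 μ) (hm : Measurable X) {θ : ℝ}
    (hθ : |θ| ≤ 1 / 32) :
    ∫⁻ ω, ENNReal.ofReal (Real.exp (θ * (X ω ^ 2 - ∫ ω', X ω' ^ 2 ∂μ))) ∂μ ≤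
      ENNReal.ofReal (Real.exp (21 * θ ^ 2)) := by
  set v := ∫ ω', X ω' ^ 2 ∂μ with hv
  have hv0 : 0 ≤ v := integral_nonneg fun ω => sq_nonneg _
  have hi := integrable_sq hX
  have he := integrable_exp_sq hX hm
  have hlin' : Integrable (fun ω => θ * (X ω ^ 2 - v)) μ :=
    (hi.sub (integrable_const _)).const_mul _
  have hlin : Integrable (fun ω => 1 + θ * (X ω ^ 2 - v)) μ := (integrable_const _).add hlin'
  have hmaj : Integrable
      (fun ω => 1 + θ * (X ω ^ 2 - v) + 10.5 * θ ^ 2 * Real.exp (3 / 8 * X ω ^ 2)) μ :=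
    hlin.add (he.const_mul _)
  have hpt := fun ω => exp_mul_sq_sub_le hθ hv0 (integral_sq_le hX hm) (X ω)
  refine (lintegral_mono fun ω => ENNReal.ofReal_le_ofReal (hpt ω)).trans ?_
  rw [← ofReal_integral_eq_lintegral_ofReal hmaj
    (ae_of_all _ fun ω => (Real.exp_pos _).le.trans (hpt ω))]
  refine ENNReal.ofReal_le_ofReal ?_
  rw [integral_add hlin (he.const_mul _), integral_const_mul,
    integral_add (integrable_const _) hlin',
    integral_const_mul, integral_sub hi (integrable_const _)]
  simp only [integral_const, smul_eq_mul, probReal_univ, one_mul, ← hv, sub_self, mul_zero,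
    add_zero]
  have := integral_exp_sq_le hX hm
  have h1 := Real.add_one_le_exp (21 * θ ^ 2)
  nlinarith [sq_nonneg θ]

/-- The one-variable case of the Hanson–Wright bound, with a linear term: the
weighted inequality of the two means decouples the centered square from the linear part. -/
theorem lintegral_exp_quadratic_le (hX : HasSubgaussianMGF X 1 μ) (hm : Measurable X) {q : ℝ}
    (hq : |q| ≤ 1 / 64) (β : ℝ) :
    ∫⁻ ω, ENNReal.ofReal (Real.exp (q * (X ω ^ 2 - ∫ ω', X ω' ^ 2 ∂μ) + 2 * β * X ω)) ∂μ ≤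
      ENNReal.ofReal (Real.exp (42 * q ^ 2 + 4 * β ^ 2)) := by
  set v := ∫ ω', X ω' ^ 2 ∂μ with hv
  have h1 := lintegral_exp_mul_sq_sub_le hX hm (θ := 2 * q)
    (by rw [abs_mul, abs_of_pos (by norm_num : (0 : ℝ) < 2)]; linarith)
  rw [← hv] at h1
  have h2 : ∫⁻ ω, ENNReal.ofReal (Real.exp (4 * β * X ω)) ∂μ ≤
      ENNReal.ofReal (Real.exp (8 * β ^ 2)) := by
    rw [← ofReal_integral_eq_lintegral_ofReal (hX.integrable_exp_mul _)
      (ae_of_all _ fun y => (Real.exp_pos _).le)]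
    refine ENNReal.ofReal_le_ofReal ((hX.mgf_le (4 * β)).trans (Real.exp_le_exp.2 ?_))
    push_cast; linarith
  -- The weights equalize the bounds for the two squares.
  set w := Real.exp (4 * β ^ 2 - 42 * q ^ 2) with hw
  set w' := Real.exp (42 * q ^ 2 - 4 * β ^ 2) with hw'
  have hpt : ∀ x : ℝ, Real.exp (q * (x ^ 2 - v) + 2 * β * x) ≤
      w / 2 * Real.exp (2 * q * (x ^ 2 - v)) + w' / 2 * Real.exp (4 * β * x) := fun x => by
    have e1 : w * Real.exp (2 * q * (x ^ 2 - v)) =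
        Real.exp ((2 * β ^ 2 - 21 * q ^ 2) + q * (x ^ 2 - v)) ^ 2 := by
      rw [← Real.exp_nat_mul, hw, ← Real.exp_add]; congr 1; push_cast; ring
    have e2 : w' * Real.exp (4 * β * x) =
        Real.exp (-(2 * β ^ 2 - 21 * q ^ 2) + 2 * β * x) ^ 2 := by
      rw [← Real.exp_nat_mul, hw', ← Real.exp_add]; congr 1; push_cast; ring
    have e3 : Real.exp (q * (x ^ 2 - v) + 2 * β * x) =
        Real.exp ((2 * β ^ 2 - 21 * q ^ 2) + q * (x ^ 2 - v)) *
        Real.exp (-(2 * β ^ 2 - 21 * q ^ 2) + 2 * β * x) := by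
      rw [← Real.exp_add]; congr 1; ring
    rw [e3]
    have := two_mul_le_add_sq (Real.exp ((2 * β ^ 2 - 21 * q ^ 2) + q * (x ^ 2 - v)))
      (Real.exp (-(2 * β ^ 2 - 21 * q ^ 2) + 2 * β * x))
    linarith
  have hw0 : 0 ≤ w / 2 := by positivity
  have hw0' : 0 ≤ w' / 2 := by positivity
  calc _ ≤ ∫⁻ ω, (ENNReal.ofReal (w / 2) * ENNReal.ofReal (Real.exp (2 * q * (X ω ^ 2 - v))) +
        ENNReal.ofReal (w' / 2) * ENNReal.ofReal (Real.exp (4 * β * X ω))) ∂μ := by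
        refine lintegral_mono fun ω => (ENNReal.ofReal_le_ofReal (hpt (X ω))).trans (le_of_eq ?_)
        rw [ENNReal.ofReal_add (by positivity) (by positivity), ENNReal.ofReal_mul hw0,
          ENNReal.ofReal_mul hw0']
    _ ≤ ENNReal.ofReal (w / 2) * ENNReal.ofReal (Real.exp (21 * (2 * q) ^ 2)) +
        ENNReal.ofReal (w' / 2) * ENNReal.ofReal (Real.exp (8 * β ^ 2)) := by
        rw [lintegral_add_left (by fun_prop), lintegral_const_mul _ (by fun_prop),
          lintegral_const_mul _ (by fun_prop)]
        gcongr
    _ = _ := by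
        rw [← ENNReal.ofReal_mul hw0, ← ENNReal.ofReal_mul hw0',
          ← ENNReal.ofReal_add (by positivity) (by positivity)]
        congr 1
        have e1 : w * Real.exp (21 * (2 * q) ^ 2) = Real.exp (42 * q ^ 2 + 4 * β ^ 2) := by
          rw [hw, ← Real.exp_add]; congr 1; ring
        have e2 : w' * Real.exp (8 * β ^ 2) = Real.exp (42 * q ^ 2 + 4 * β ^ 2) := by
          rw [hw', ← Real.exp_add]; congr 1; ring
        linarith

end OneVariable
end OTA

/-! ### Quadratic forms in independent variables -/

namespace OTA

/-- The quadratic form `xᵀ Q x`. -/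
def quad {n : ℕ} (Q : Fin n → Fin n → ℝ) (x : Fin n → ℝ) : ℝ := ∑ i, ∑ j, Q i j * x i * x j

theorem quad_cons {n : ℕ} (Q : Fin (n + 1) → Fin (n + 1) → ℝ) (hQ : ∀ i j, Q i j = Q j i)
    (r : ℝ) (y : Fin n → ℝ) :
    quad Q (Fin.cons r y) = Q 0 0 * r ^ 2 + 2 * (∑ i, Q 0 i.succ * y i) * r +
      quad (fun i j => Q i.succ j.succ) y := by
  have h : ∀ i : Fin n, Q i.succ 0 = Q 0 i.succ := fun i => hQ _ _
  simp only [quad, Fin.sum_univ_succ, Fin.cons_zero, Fin.cons_succ, h, Finset.sum_add_distrib,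
    Finset.mul_sum, Finset.sum_mul]
  have h1 : ∑ i, Q 0 i.succ * r * y i = ∑ i, Q 0 i.succ * y i * r :=
    Finset.sum_congr rfl fun i _ => by ring
  have h2 : ∑ i, 2 * (Q 0 i.succ * y i) * r = 2 * ∑ i, Q 0 i.succ * y i * r := by
    rw [Finset.mul_sum]; exact Finset.sum_congr rfl fun i _ => by ring
  rw [h1, h2]; ring

theorem quad_add_rankOne {n : ℕ} (Q : Fin n → Fin n → ℝ) (b x : Fin n → ℝ) :
    quad (fun i j => Q i j + 4 * (b i * b j)) x = quad Q x + 4 * (∑ i, b i * x i) ^ 2 := by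
  rw [sq, Finset.sum_mul_sum]
  simp only [quad, Finset.mul_sum, ← Finset.sum_add_distrib]
  exact Finset.sum_congr rfl fun i _ => Finset.sum_congr rfl fun j _ => by ring

theorem sum_sq_add_rankOne {n : ℕ} (Q : Fin n → Fin n → ℝ) (b : Fin n → ℝ) :
    ∑ i, ∑ j, (Q i j + 4 * (b i * b j)) ^ 2 =
      ∑ i, ∑ j, Q i j ^ 2 + 8 * quad Q b + 16 * (∑ i, b i ^ 2) ^ 2 := by
  rw [sq (∑ i, b i ^ 2), Finset.sum_mul_sum]
  simp only [quad, Finset.mul_sum, ← Finset.sum_add_distrib]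
  exact Finset.sum_congr rfl fun i _ => Finset.sum_congr rfl fun j _ => by ring

theorem lintegral_pi_succ {n : ℕ} (ν : Fin (n + 1) → Measure ℝ) [∀ i, IsProbabilityMeasure (ν i)]
    {g : (Fin (n + 1) → ℝ) → ℝ≥0∞} (hg : Measurable g) :
    ∫⁻ x, g x ∂Measure.pi ν =
      ∫⁻ y, ∫⁻ r, g (Fin.cons r y) ∂ν 0 ∂Measure.pi (fun i : Fin n => ν i.succ) := by
  have h := (measurePreserving_piFinSuccAbove ν 0).symm
  rw [← h.lintegral_comp hg, 
    lintegral_prod_symm' (fun p => g ((MeasurableEquiv.piFinSuccAbove (fun _ => ℝ) 0).symm p))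
      (hg.comp h.measurable)]
  simp [MeasurableEquiv.piFinSuccAbove, Fin.insertNthEquiv]

/-- **Hanson–Wright bound** for the moment generating function of a centered quadratic form in
independent variables, by integrating out one coordinate at a time. If `b` is the off-diagonal part
of the row of the coordinate, integrating it out adds `4 b bᵀ` to the form in the other
coordinates. -/
theorem lintegral_exp_quad_le {n : ℕ} (ν : Fin n → Measure ℝ) [∀ i, IsProbabilityMeasure (ν i)]
    (v : Fin n → ℝ) (hv : ∀ i, v i ≤ 2)
    (hν : ∀ i (q β : ℝ), |q| ≤ 1 / 64 →
      ∫⁻ x, ENNReal.ofReal (Real.exp (q * (x ^ 2 - v i) + 2 * β * x)) ∂ν i ≤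
        ENNReal.ofReal (Real.exp (42 * q ^ 2 + 4 * β ^ 2)))
    (Q : Fin n → Fin n → ℝ) (hQ : ∀ i j, Q i j = Q j i)
    (hb : ∀ x, |quad Q x| ≤ 1 / 64 * ∑ i, x i ^ 2) :
    ∫⁻ x, ENNReal.ofReal (Real.exp (quad Q x - ∑ i, Q i i * v i)) ∂Measure.pi ν ≤
      ENNReal.ofReal (Real.exp (42 * ∑ i, ∑ j, Q i j ^ 2)) := by
  induction n with
  | zero => simp [quad]
  | succ n ih =>
    set q := Q 0 0 with hq_def
    set b : Fin n → ℝ := fun i => Q 0 i.succ with hb_def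
    set Q' : Fin n → Fin n → ℝ := fun i j => Q i.succ j.succ with hQ'_def
    have hcons : ∀ r y, |q * r ^ 2 + 2 * (∑ i, b i * y i) * r + quad Q' y| ≤
        1 / 64 * (r ^ 2 + ∑ i, y i ^ 2) := fun r y => by
      have := hb (Fin.cons r y)
      rwa [quad_cons Q hQ, Fin.sum_univ_succ] at this
    have hq : |q| ≤ 1 / 64 := by simpa [quad] using hcons 1 0
    -- The vector `(32 bᵀy, y)` shows that the form stays small after the first
    -- coordinate has been integrated out, as in a Schur complement.
    have hb'' : ∀ y, |quad (fun i j => Q' i j + 4 * (b i * b j)) y| ≤ 1 / 64 * ∑ i, y i ^ 2 := by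
      intro y
      rw [quad_add_rankOne]
      have h1 := (abs_le.1 (hcons (32 * ∑ i, b i * y i) y)).2
      have h2 := (abs_le.1 (hcons 0 y)).1
      have h3 := (abs_le.1 hq).1
      have h4 := sq_nonneg (∑ i, b i * y i)
      rw [abs_le]
      constructor
      · norm_num at h2; linarith
      · nlinarith
    have hmeas : Measurable fun x : Fin (n + 1) → ℝ =>
        ENNReal.ofReal (Real.exp (quad Q x - ∑ i, Q i i * v i)) := by
      unfold quad; fun_prop
    rw [lintegral_pi_succ ν hmeas]
    have hstep : ∀ y : Fin n → ℝ,
        ∫⁻ r, ENNReal.ofReal (Real.exp (quad Q (Fin.cons r y) - ∑ i, Q i i * v i)) ∂ν 0 ≤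
        ENNReal.ofReal (Real.exp (42 * q ^ 2 + 8 * ∑ i, b i ^ 2)) *
          ENNReal.ofReal (Real.exp (quad (fun i j => Q' i j + 4 * (b i * b j)) y -
            ∑ i, (Q' i i + 4 * (b i * b i)) * v i.succ)) := by
      intro y
      have h1 : ∀ r, ENNReal.ofReal (Real.exp (quad Q (Fin.cons r y) - ∑ i, Q i i * v i)) =
          ENNReal.ofReal (Real.exp (q * (r ^ 2 - v 0) + 2 * (∑ i, b i * y i) * r)) *
          ENNReal.ofReal (Real.exp (quad Q' y - ∑ i, Q' i i * v i.succ)) := fun r => by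
        rw [← ENNReal.ofReal_mul (Real.exp_pos _).le, ← Real.exp_add, quad_cons Q hQ,
          Fin.sum_univ_succ]
        congr 2; ring
      simp_rw [h1]
      rw [lintegral_mul_const _ (by fun_prop)]
      refine (mul_le_mul_left (hν 0 q (∑ i, b i * y i) hq) _).trans ?_
      rw [← ENNReal.ofReal_mul (Real.exp_pos _).le, ← ENNReal.ofReal_mul (Real.exp_pos _).le,
        ← Real.exp_add, ← Real.exp_add]
      refine ENNReal.ofReal_le_ofReal (Real.exp_le_exp.2 ?_)
      have h2 : ∑ i, (Q' i i + 4 * (b i * b i)) * v i.succ ≤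
          ∑ i, Q' i i * v i.succ + 8 * ∑ i, b i ^ 2 := by
        rw [Finset.mul_sum, ← Finset.sum_add_distrib]
        refine Finset.sum_le_sum fun i _ => ?_
        nlinarith [hv i.succ, mul_nonneg (sq_nonneg (b i)) (sub_nonneg.2 (hv i.succ))]
      rw [quad_add_rankOne]
      linarith
    refine (lintegral_mono hstep).trans ?_
    rw [lintegral_const_mul _ (by unfold quad; fun_prop)]
    refine (mul_le_mul_right (ih (fun i => ν i.succ) (fun i => v i.succ) (fun i => hv _)
      (fun i => hν _) (fun i j => Q' i j + 4 * (b i * b j))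
      (fun i j => by rw [hQ'_def]; simp only; rw [hQ, mul_comm (b i)]) hb'') _).trans ?_
    rw [← ENNReal.ofReal_mul (Real.exp_pos _).le, ← Real.exp_add]
    refine ENNReal.ofReal_le_ofReal (Real.exp_le_exp.2 ?_)
    have h1 := (abs_le.1 (hb'' b)).2
    rw [quad_add_rankOne] at h1
    have h2 : ∑ i, b i * b i = ∑ i, b i ^ 2 := Finset.sum_congr rfl fun i _ => (sq _).symm
    rw [h2] at h1
    have h3 : ∑ i, ∑ j, Q i j ^ 2 = q ^ 2 + 2 * ∑ i, b i ^ 2 + ∑ i, ∑ j, Q' i j ^ 2 := by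
      simp only [Fin.sum_univ_succ, Finset.sum_add_distrib]
      have : ∑ i : Fin n, Q i.succ 0 ^ 2 = ∑ i, b i ^ 2 :=
        Finset.sum_congr rfl fun i _ => by rw [hQ]
      rw [this]; ring
    rw [sum_sq_add_rankOne, h3]
    have h4 : 0 ≤ ∑ i, b i ^ 2 := Finset.sum_nonneg fun i _ => sq_nonneg _
    nlinarith [sq_nonneg (∑ i, b i ^ 2)]

end OTA

/-! ### Gram matrices, Minkowski and Hoeffding -/

namespace OTA

section GramForm

theorem sum_sq_gram {ι : Type*} [Fintype ι] {n : ℕ} (W : ι → Fin n → ℝ) (t : ℝ) (x : Fin n → ℝ) :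
    quad (fun i j => t * ∑ r, W r i * W r j) x = t * ∑ r, (∑ l, W r l * x l) ^ 2 := by
  simp only [quad, sq, Finset.sum_mul_sum]
  simp only [Finset.mul_sum, Finset.sum_mul]
  rw [Finset.sum_comm (s := (Finset.univ : Finset ι))]
  refine Finset.sum_congr rfl fun i _ => ?_
  rw [Finset.sum_comm]
  exact Finset.sum_congr rfl fun r _ => Finset.sum_congr rfl fun j _ => by ring

/-- `‖Wᵀ W‖_F² ≤ ‖W‖_op² ‖W‖_F²`, with `κ` in the role of `‖W‖_op²`. -/
theorem sum_gram_sq_le {ι : Type*} [Fintype ι] {n : ℕ} (W : ι → Fin n → ℝ) {κ : ℝ}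
    (hκ : ∀ x : Fin n → ℝ, ∑ r, (∑ l, W r l * x l) ^ 2 ≤ κ * ∑ l, x l ^ 2) :
    ∑ i, ∑ j, (∑ r, W r i * W r j) ^ 2 ≤ κ * ∑ r, ∑ l, W r l ^ 2 := by
  have h : ∑ i, ∑ j, (∑ r, W r i * W r j) ^ 2 = ∑ s, ∑ r, (∑ l, W r l * W s l) ^ 2 := by
    simp only [sq, Finset.sum_mul_sum]
    simp only [← Fintype.sum_prod_type']
    exact Fintype.sum_equiv ⟨fun p => (p.2.2.1, p.2.2.2, p.1, p.2.1),
      fun p => (p.2.2.1, p.2.2.2, p.1, p.2.1), fun _ => rfl, fun _ => rfl⟩ _ _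
      fun p => by simp only [Equiv.coe_fn_mk]; ring
  rw [h, Finset.mul_sum]
  exact Finset.sum_le_sum fun s _ => hκ (W s)

/-- The squared norm of a row is at most the squared operator norm. -/
theorem sum_row_sq_le {ι : Type*} [Fintype ι] {n : ℕ} (W : ι → Fin n → ℝ) {κ : ℝ}
    (hκ : ∀ x : Fin n → ℝ, ∑ r, (∑ l, W r l * x l) ^ 2 ≤ κ * ∑ l, x l ^ 2) (hκ0 : 0 ≤ κ) (r : ι) :
    ∑ l, W r l ^ 2 ≤ κ := by
  have h1 : (∑ l, W r l * W r l) ^ 2 ≤ κ * ∑ l, W r l ^ 2 :=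
    (Finset.single_le_sum (f := fun s => (∑ l, W s l * W r l) ^ 2) (fun _ _ => sq_nonneg _)
      (Finset.mem_univ r)).trans (hκ (W r))
  simp only [← sq] at h1
  have h2 : 0 ≤ ∑ l, W r l ^ 2 := Finset.sum_nonneg fun _ _ => sq_nonneg _
  by_contra! h
  nlinarith

variable {Ω : Type*} [MeasurableSpace Ω] {μ : Measure Ω} [IsProbabilityMeasure μ]

/-- The Hanson–Wright bound for `‖W X‖²`, where `X` has independent sub-Gaussian entries. -/
theorem lintegral_exp_gram_le {ι : Type*} [Fintype ι] {n : ℕ} {X : Fin n → Ω → ℝ}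
    (hX : ∀ i, HasSubgaussianMGF (X i) 1 μ) (hm : ∀ i, Measurable (X i)) (hind : iIndepFun X μ)
    (W : ι → Fin n → ℝ) {κ t : ℝ}
    (hκ : ∀ x : Fin n → ℝ, ∑ r, (∑ l, W r l * x l) ^ 2 ≤ κ * ∑ l, x l ^ 2)
    (ht : |t| * κ ≤ 1 / 64) :
    ∫⁻ ω, ENNReal.ofReal (Real.exp (t * (∑ r, (∑ l, W r l * X l ω) ^ 2 -
        ∑ r, ∑ l, W r l ^ 2 * ∫ ω', X l ω' ^ 2 ∂μ))) ∂μ ≤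
      ENNReal.ofReal (Real.exp (42 * t ^ 2 * (κ * ∑ r, ∑ l, W r l ^ 2))) := by
  have hpm : ∀ i, IsProbabilityMeasure (μ.map (X i)) := fun i =>
    Measure.isProbabilityMeasure_map (hm i).aemeasurable
  have hHW := lintegral_exp_quad_le (fun i => μ.map (X i)) (fun i => ∫ ω', X i ω' ^ 2 ∂μ)
    (fun i => integral_sq_le (hX i) (hm i))
    (fun i q β hq => by
      rw [lintegral_map (by fun_prop) (hm i)]
      exact lintegral_exp_quadratic_le (hX i) (hm i) hq β)
    (fun i j => t * ∑ r, W r i * W r j) (fun i j => by simp only [mul_comm])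
    (fun x => by
      rw [sum_sq_gram, abs_mul,
        abs_of_nonneg (a := ∑ r, (∑ l, W r l * x l) ^ 2)
          (Finset.sum_nonneg fun r _ => sq_nonneg _)]
      calc _ ≤ |t| * (κ * ∑ l, x l ^ 2) := mul_le_mul_of_nonneg_left (hκ x) (abs_nonneg _)
        _ = |t| * κ * ∑ l, x l ^ 2 := by ring
        _ ≤ _ := mul_le_mul_of_nonneg_right ht (Finset.sum_nonneg fun _ _ => sq_nonneg _))
  have hmX : Measurable fun ω i => X i ω := measurable_pi_lambda _ hm
  rw [← (iIndepFun_iff_map_fun_eq_pi_map fun i => (hm i).aemeasurable).1 hind,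
    lintegral_map (by unfold quad; fun_prop) hmX] at hHW
  refine (le_of_eq ?_).trans (hHW.trans (ENNReal.ofReal_le_ofReal (Real.exp_le_exp.2 ?_)))
  · refine lintegral_congr fun ω => ?_
    rw [sum_sq_gram, mul_sub]
    congr 4
    simp only [Finset.mul_sum, Finset.sum_mul]
    rw [Finset.sum_comm]
    exact Finset.sum_congr rfl fun i _ => Finset.sum_congr rfl fun r _ => by ring
  · have := sum_gram_sq_le W hκ
    simp only [mul_pow, ← Finset.mul_sum]
    nlinarith [mul_le_mul_of_nonneg_left this (sq_nonneg t)]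

end GramForm

section Minkowski

theorem sqrt_sum_add_sq_le {ι : Type*} [Fintype ι] (p q : ι → ℝ) :
    Real.sqrt (∑ i, (p i + q i) ^ 2) ≤
      Real.sqrt (∑ i, p i ^ 2) + Real.sqrt (∑ i, q i ^ 2) := by
  have := norm_add_le (WithLp.toLp 2 p : EuclideanSpace ℝ ι) (WithLp.toLp 2 q)
  simpa [EuclideanSpace.norm_eq] using this

theorem sum_sq_le_of_abs_le_add {ι : Type*} [Fintype ι] {z p q : ι → ℝ} {a b : ℝ}
    (hz : ∀ i, |z i| ≤ p i + q i) (hp : ∑ i, p i ^ 2 ≤ a ^ 2) (hq : ∑ i, q i ^ 2 ≤ b ^ 2)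
    (ha : 0 ≤ a) (hb : 0 ≤ b) : ∑ i, z i ^ 2 ≤ (a + b) ^ 2 := by
  have h1 : ∑ i, z i ^ 2 ≤ ∑ i, (p i + q i) ^ 2 :=
    Finset.sum_le_sum fun i _ => sq_le_sq' (abs_le.1 (hz i)).1 (abs_le.1 (hz i)).2
  have h2 := sqrt_sum_add_sq_le p q
  have h3 := Real.sqrt_le_sqrt hp
  have h4 := Real.sqrt_le_sqrt hq
  rw [Real.sqrt_sq ha] at h3
  rw [Real.sqrt_sq hb] at h4
  exact h1.trans ((Real.sqrt_le_left (by positivity)).1 (h2.trans (add_le_add h3 h4)))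

theorem sum_mulVec_sq_le_opNorm {m n : Type*} [Fintype m] [Fintype n] [DecidableEq n]
    (A : Matrix m n ℝ) (x : n → ℝ) :
    ∑ i, (∑ j, A i j * x j) ^ 2 ≤ opNorm A ^ 2 * ∑ j, x j ^ 2 := by
  have h := (LinearMap.toContinuousLinearMap (Matrix.toEuclideanLin A)).le_opNorm (WithLp.toLp 2 x)
  have h2 := pow_le_pow_left₀ (norm_nonneg _) h 2
  rw [mul_pow, EuclideanSpace.norm_sq_eq, EuclideanSpace.norm_sq_eq] at h2
  simpa [opNorm, Matrix.toLpLin_apply, Matrix.mulVec, dotProduct] using h2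

theorem opNorm_nonneg {m n : Type*} [Fintype m] [Fintype n] [DecidableEq n]
    (A : Matrix m n ℝ) : 0 ≤ opNorm A := norm_nonneg _

theorem frobNorm_nonneg {m n : Type*} [Fintype m] [Fintype n] (A : Matrix m n ℝ) :
    0 ≤ frobNorm A := Real.sqrt_nonneg _

theorem frobNorm_sq {m n : Type*} [Fintype m] [Fintype n] (A : Matrix m n ℝ) :
    frobNorm A ^ 2 = ∑ i, ∑ j, A i j ^ 2 :=
  Real.sq_sqrt (Finset.sum_nonneg fun _ _ => Finset.sum_nonneg fun _ _ => sq_nonneg _)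

end Minkowski

section Hoeffding

variable {ι : Type*} [Fintype ι] {T : ι → Type*} [∀ i, MeasurableSpace (T i)]

/-- Hoeffding's inequality for the moment generating function, on a product space. -/
theorem lintegral_exp_sum_sub_integral_le (π : ∀ i, Measure (T i))
    [∀ i, IsProbabilityMeasure (π i)] {g : ∀ i, T i → ℝ} (hg : ∀ i, Measurable (g i)) {c : ι → ℝ}
    (h0 : ∀ i x, 0 ≤ g i x) (hc : ∀ i x, g i x ≤ c i) (hc0 : ∀ i, 0 ≤ c i) (t : ℝ) :
    ∫⁻ x, ENNReal.ofReal (Real.exp (t * (∑ i, g i (x i) - ∑ i, ∫ y, g i y ∂π i))) ∂Measure.pi π ≤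
      ENNReal.ofReal (Real.exp (t ^ 2 / 8 * ∑ i, c i ^ 2)) := by
  have h1 : ∀ i, HasSubgaussianMGF (fun x : ∀ i, T i => g i (x i) - ∫ y, g i y ∂π i)
      ((‖c i - 0‖₊ / 2) ^ 2) (Measure.pi π) := fun i => by
    have h := hasSubgaussianMGF_of_mem_Icc (μ := π i) (hg i).aemeasurable
      (ae_of_all _ fun x => ⟨h0 i x, hc i x⟩)
    rw [← (measurePreserving_eval π i).map_eq] at h ⊢
    have := HasSubgaussianMGF.of_map (Y := fun x : ∀ i, T i => x i)
      (measurable_pi_apply i).aemeasurable h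
    exact this
  have h2 : iIndepFun (fun i (x : ∀ i, T i) => g i (x i) - ∫ y, g i y ∂π i) (Measure.pi π) :=
    iIndepFun_pi (X := fun i y => g i y - ∫ y, g i y ∂π i)
      fun i => ((hg i).sub_const _).aemeasurable
  have h3 := HasSubgaussianMGF.sum_of_iIndepFun h2 (s := Finset.univ) fun i _ => h1 i
  simp only [Finset.sum_sub_distrib] at h3
  rw [← ofReal_integral_eq_lintegral_ofReal (h3.integrable_exp_mul t)
    (ae_of_all _ fun y => (Real.exp_pos _).le)]
  refine ENNReal.ofReal_le_ofReal ((h3.mgf_le t).trans (Real.exp_le_exp.2 (le_of_eq ?_)))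
  push_cast
  rw [Finset.sum_mul, Finset.sum_div, Finset.mul_sum]
  refine Finset.sum_congr rfl fun i _ => ?_
  rw [sub_zero, Real.norm_of_nonneg (hc0 i)]; ring

end Hoeffding
end OTA

/-! ### Random signs and the rows they mix -/

namespace OTA

section Signs

/-- The law of a fair coin. -/
noncomputable def coin : Measure Bool := (PMF.uniformOfFintype Bool).toMeasure

instance : IsProbabilityMeasure coin := by unfold coin; infer_instance

/-- The sign `±1` encoded by a bit. -/
def sign (b : Bool) : ℝ := if b then 1 else -1

theorem sign_sq (b : Bool) : sign b ^ 2 = 1 := by cases b <;> simp [sign]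

theorem integral_coin (f : Bool → ℝ) : ∫ b, f b ∂coin = (f true + f false) / 2 := by
  rw [coin, PMF.integral_eq_sum]
  simp; ring

theorem variance_mul_sign (c : ℝ) : variance (fun b => c * sign b) coin = c ^ 2 := by
  rw [variance_eq_sub (MemLp.of_discrete), integral_coin, integral_coin]
  simp [sign]

/-- Fair signs are orthonormal, so that all cross terms cancel in the mean. -/
theorem integral_sum_sign_add_sq {ι : Type*} [Fintype ι] (c : ι → ℝ) (b : ℝ) :
    ∫ w : ι → Bool, (∑ k, c k * sign (w k) + b) ^ 2 ∂Measure.pi (fun _ => coin) =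
      ∑ k, c k ^ 2 + b ^ 2 := by
  have h1 := variance_sum_pi (μ := fun _ : ι => coin) (X := fun k y => c k * sign y)
    fun k => MemLp.of_discrete
  have h0 : ∫ w : ι → Bool, (∑ k, fun w : ι → Bool => c k * sign (w k)) w
      ∂Measure.pi (fun _ => coin) = 0 := by
    simp only [Finset.sum_apply]
    rw [integral_finsetSum _ fun _ _ => Integrable.of_finite]
    refine Finset.sum_eq_zero fun k _ => ?_
    rw [integral_comp_eval (μ := fun _ : ι => coin) (f := fun y => c k * sign y)
      (measurable_of_finite _).aestronglyMeasurable, integral_coin]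
    simp [sign]
  rw [variance_eq_sub MemLp.of_discrete, h0] at h1
  simp only [variance_mul_sign, Pi.pow_apply, Finset.sum_apply] at h0 h1
  have h2 : ∀ w : ι → Bool, (∑ k, c k * sign (w k) + b) ^ 2 =
      (∑ k, c k * sign (w k)) ^ 2 + (2 * b * ∑ k, c k * sign (w k) + b ^ 2) := fun w => by ring
  simp_rw [h2]
  rw [integral_add Integrable.of_finite Integrable.of_finite,
    integral_add Integrable.of_finite Integrable.of_finite, integral_const_mul, h0]
  simp at h1 ⊢
  exact h1

/-- Independent fair bits indexed by `κ × ι` may be grouped by either index. -/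
theorem measurePreserving_swap_coin (κ ι : Type*) [Fintype κ] [Fintype ι] :
    MeasurePreserving (fun (u : κ → ι → Bool) i k => u k i)
      (Measure.pi fun _ => Measure.pi fun _ => coin)
      (Measure.pi fun _ => Measure.pi fun _ => coin) := by
  refine ⟨by fun_prop, Measure.ext_of_singleton fun w => ?_⟩
  rw [Measure.map_apply (by fun_prop) (measurableSet_singleton _)]
  have : (fun (u : κ → ι → Bool) i k => u k i) ⁻¹' {w} = {fun k i => w i k} := by
    ext u; simp only [Set.mem_preimage, Set.mem_singleton_iff, funext_iff]
    exact ⟨fun h k i => h i k, fun h i k => h k i⟩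
  rw [this]
  simp only [Measure.pi_singleton]
  exact Finset.prod_comm

end Signs

section MixedRows

variable {K M n : ℕ}

/-- The entry `(r, l)` of the matrix that maps the source to the channel output, when transmitter
`k` sends `c k` with the sign `w k`. -/
def mixedRow (A : Matrix (FadingIdx K M) (Fin n) ℝ) (B : Matrix (NoiseIdx M) (Fin n) ℝ)
    (c : Fin K → ℝ) (w : Fin K → Bool) (r : NoiseIdx M) (l : Fin n) : ℝ :=
  ∑ k, c k * sign (w k) * A (r.1, r.2, k) l + B r l

theorem abs_sum_sign_mul_add_le {c : Fin K → ℝ} {α : ℝ} (hα : 0 ≤ α) (hc : ∑ k, c k ^ 2 ≤ α ^ 2)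
    (w : Fin K → Bool) (y : Fin K → ℝ) (b : ℝ) :
    |∑ k, c k * sign (w k) * y k + b| ≤ α * Real.sqrt (∑ k, y k ^ 2) + |b| := by
  refine (abs_add_le _ _).trans (add_le_add ?_ le_rfl)
  have h := Finset.sum_mul_sq_le_sq_mul_sq Finset.univ (fun k => c k * sign (w k)) y
  simp only [mul_pow, sign_sq, mul_one] at h
  rw [← Real.sqrt_sq hα, ← Real.sqrt_mul (sq_nonneg α)]
  refine Real.abs_le_sqrt (h.trans (mul_le_mul_of_nonneg_right hc ?_))
  exact Finset.sum_nonneg fun _ _ => sq_nonneg _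

theorem sum_mixedRow_mul (A : Matrix (FadingIdx K M) (Fin n) ℝ) (B : Matrix (NoiseIdx M) (Fin n) ℝ)
    (c : Fin K → ℝ) (w : Fin K → Bool) (r : NoiseIdx M) (x : Fin n → ℝ) :
    ∑ l, mixedRow A B c w r l * x l =
      ∑ k, c k * sign (w k) * (∑ l, A (r.1, r.2, k) l * x l) + ∑ l, B r l * x l := by
  simp only [mixedRow, add_mul, Finset.sum_add_distrib, Finset.sum_mul, Finset.mul_sum]
  rw [Finset.sum_comm]
  congr 1
  exact Finset.sum_congr rfl fun k _ => Finset.sum_congr rfl fun l _ => by ring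

theorem sum_fadingIdx (g : FadingIdx K M → ℝ) :
    ∑ r : NoiseIdx M, ∑ k, g (r.1, r.2, k) = ∑ i, g i := by
  simp only [Fintype.sum_prod_type]

/-- The operator norm of the matrix `mixedRow`, for arbitrary signs. -/
theorem sum_mixedRow_mul_sq_le (A : Matrix (FadingIdx K M) (Fin n) ℝ)
    (B : Matrix (NoiseIdx M) (Fin n) ℝ) {c : Fin K → ℝ} {α : ℝ} (hα : 0 ≤ α)
    (hc : ∑ k, c k ^ 2 ≤ α ^ 2) (w : Fin M → Fin K → Bool) (x : Fin n → ℝ) :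
    ∑ r, (∑ l, mixedRow A B c (w r.1) r l * x l) ^ 2 ≤
      (α * opNorm A + opNorm B) ^ 2 * ∑ l, x l ^ 2 := by
  have hx : 0 ≤ ∑ l, x l ^ 2 := Finset.sum_nonneg fun _ _ => sq_nonneg _
  have h := sum_sq_le_of_abs_le_add (z := fun r => ∑ l, mixedRow A B c (w r.1) r l * x l)
    (p := fun r => α * Real.sqrt (∑ k, (∑ l, A (r.1, r.2, k) l * x l) ^ 2))
    (q := fun r => |∑ l, B r l * x l|) (a := α * opNorm A * Real.sqrt (∑ l, x l ^ 2))
    (b := opNorm B * Real.sqrt (∑ l, x l ^ 2))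
    (fun r => by rw [sum_mixedRow_mul]; exact abs_sum_sign_mul_add_le hα hc _ _ _)
    (by
      simp only [mul_pow, Real.sq_sqrt hx,
        Real.sq_sqrt (Finset.sum_nonneg fun _ _ => sq_nonneg _)]
      rw [← Finset.mul_sum, sum_fadingIdx fun i => (∑ l, A i l * x l) ^ 2, mul_assoc]
      exact mul_le_mul_of_nonneg_left (sum_mulVec_sq_le_opNorm A x) (sq_nonneg _))
    (by
      simp only [mul_pow, Real.sq_sqrt hx, sq_abs]
      exact sum_mulVec_sq_le_opNorm B x)
    (by have := opNorm_nonneg A; positivity) (by have := opNorm_nonneg B; positivity)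
  refine h.trans (le_of_eq ?_)
  rw [← add_mul, mul_pow, Real.sq_sqrt hx]

/-- A bound for the squared Euclidean norm of a row of the matrix `mixedRow` that does not depend
on the signs. -/
noncomputable def rowBound (A : Matrix (FadingIdx K M) (Fin n) ℝ)
    (B : Matrix (NoiseIdx M) (Fin n) ℝ) (α : ℝ) (r : NoiseIdx M) : ℝ :=
  ∑ l, (α * Real.sqrt (∑ k, A (r.1, r.2, k) l ^ 2) + |B r l|) ^ 2

theorem sum_mixedRow_sq_le_rowBound (A : Matrix (FadingIdx K M) (Fin n) ℝ)
    (B : Matrix (NoiseIdx M) (Fin n) ℝ) {c : Fin K → ℝ} {α : ℝ} (hα : 0 ≤ α) (hc : ∑ k, c k ^ 2 ≤ α ^ 2)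
    (w : Fin K → Bool) (r : NoiseIdx M) : ∑ l, mixedRow A B c w r l ^ 2 ≤ rowBound A B α r := by
  refine Finset.sum_le_sum fun l _ => ?_
  have h := abs_sum_sign_mul_add_le hα hc w (fun k => A (r.1, r.2, k) l) (B r l)
  exact sq_le_sq' (abs_le.1 h).1 (abs_le.1 h).2

theorem sum_rowBound_le (A : Matrix (FadingIdx K M) (Fin n) ℝ) (B : Matrix (NoiseIdx M) (Fin n) ℝ)
    {α : ℝ} (hα : 0 ≤ α) :
    ∑ r, rowBound A B α r ≤ (α * frobNorm A + frobNorm B) ^ 2 := by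
  have h := sum_sq_le_of_abs_le_add (ι := NoiseIdx M × Fin n)
    (z := fun p => α * Real.sqrt (∑ k, A (p.1.1, p.1.2, k) p.2 ^ 2) + |B p.1 p.2|)
    (p := fun p => α * Real.sqrt (∑ k, A (p.1.1, p.1.2, k) p.2 ^ 2))
    (q := fun p => |B p.1 p.2|) (a := α * frobNorm A) (b := frobNorm B)
    (fun p => (abs_of_nonneg (by positivity)).le)
    (by
      simp only [mul_pow, Real.sq_sqrt (Finset.sum_nonneg fun _ _ => sq_nonneg _)]
      rw [← Finset.mul_sum, frobNorm_sq, Fintype.sum_prod_type,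
        ← sum_fadingIdx fun i => ∑ l, A i l ^ 2]
      refine le_of_eq (congrArg _ (Finset.sum_congr rfl fun r _ => Finset.sum_comm)))
    (by
      simp only [sq_abs]
      rw [frobNorm_sq, Fintype.sum_prod_type])
    (mul_nonneg hα (frobNorm_nonneg A)) (frobNorm_nonneg B)
  rw [Fintype.sum_prod_type] at h
  exact h

end MixedRows
end OTA

/-! ### Concentration of the received energy -/

namespace OTA

section Energy

variable {K M n : ℕ}

theorem integral_mixedRow_sq (A : Matrix (FadingIdx K M) (Fin n) ℝ)
    (B : Matrix (NoiseIdx M) (Fin n) ℝ) (c : Fin K → ℝ) (r : NoiseIdx M) (l : Fin n) :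
    ∫ w, mixedRow A B c w r l ^ 2 ∂Measure.pi (fun _ => coin) =
      ∑ k, (c k * A (r.1, r.2, k) l) ^ 2 + B r l ^ 2 := by
  rw [← integral_sum_sign_add_sq]
  simp only [mixedRow, mul_right_comm]

theorem integral_sum_mixedRow_sq (A : Matrix (FadingIdx K M) (Fin n) ℝ)
    (B : Matrix (NoiseIdx M) (Fin n) ℝ) (c : Fin K → ℝ) (v : Fin n → ℝ) (m : Fin M) :
    ∫ w, ∑ j, ∑ l, mixedRow A B c w (m, j) l ^ 2 * v l ∂Measure.pi (fun _ => coin) =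
      ∑ j, ∑ l, (∑ k, (c k * A (m, j, k) l) ^ 2 + B (m, j) l ^ 2) * v l := by
  rw [integral_finsetSum _ fun _ _ => Integrable.of_finite]
  refine Finset.sum_congr rfl fun j _ => ?_
  rw [integral_finsetSum _ fun _ _ => Integrable.of_finite]
  refine Finset.sum_congr rfl fun l _ => ?_
  rw [integral_mul_const, integral_mixedRow_sq]

/-- Over the signs, the conditional mean energy is a sum of independent bounded terms, one for each
channel use. -/
theorem lintegral_exp_condMean_le (A : Matrix (FadingIdx K M) (Fin n) ℝ)
    (B : Matrix (NoiseIdx M) (Fin n) ℝ) {c : Fin K → ℝ} {α : ℝ} (hα : 0 ≤ α)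
    (hc : ∑ k, c k ^ 2 ≤ α ^ 2) {v : Fin n → ℝ} (hv0 : ∀ l, 0 ≤ v l) (hv : ∀ l, v l ≤ 2) (t : ℝ) :
    ∫⁻ u : Fin K → Fin M → Bool, ENNReal.ofReal (Real.exp (t *
        (∑ r, ∑ l, mixedRow A B c (fun k => u k r.1) r l ^ 2 * v l -
          ∑ r, ∑ l, (∑ k, (c k * A (r.1, r.2, k) l) ^ 2 + B r l ^ 2) * v l)))
        ∂Measure.pi (fun _ => Measure.pi fun _ => coin) ≤
      ENNReal.ofReal (Real.exp (t ^ 2 *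
        ((α * opNorm A + opNorm B) ^ 2 * (α * frobNorm A + frobNorm B) ^ 2))) := by
  set κ := (α * opNorm A + opNorm B) ^ 2
  set g : Fin M → (Fin K → Bool) → ℝ := fun m w => ∑ j, ∑ l, mixedRow A B c w (m, j) l ^ 2 * v l
    with hg
  have hκ0 : 0 ≤ κ := sq_nonneg _
  have hρ0 : ∀ r, 0 ≤ rowBound A B α r := fun r => Finset.sum_nonneg fun _ _ => sq_nonneg _
  have hrow : ∀ m w j, ∑ l, mixedRow A B c w (m, j) l ^ 2 * v l ≤
      2 * min κ (rowBound A B α (m, j)) := fun m w j => by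
    have h1 : ∑ l, mixedRow A B c w (m, j) l ^ 2 ≤ min κ (rowBound A B α (m, j)) :=
      le_min (sum_row_sq_le (fun r l => mixedRow A B c w r l)
        (fun x => sum_mixedRow_mul_sq_le A B hα hc (fun _ => w) x) hκ0 (m, j))
        (sum_mixedRow_sq_le_rowBound A B hα hc w (m, j))
    refine le_trans ?_ (mul_le_mul_of_nonneg_left h1 zero_le_two)
    rw [Finset.mul_sum]
    refine Finset.sum_le_sum fun l _ => ?_
    rw [mul_comm 2]
    exact mul_le_mul_of_nonneg_left (hv l) (sq_nonneg _)
  have hH := lintegral_exp_sum_sub_integral_le (fun _ : Fin M => Measure.pi fun _ : Fin K => coin)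
    (g := g) (fun m => measurable_of_finite _)
    (c := fun m => ∑ j, 2 * min κ (rowBound A B α (m, j)))
    (fun m w => Finset.sum_nonneg fun j _ => Finset.sum_nonneg fun l _ =>
      mul_nonneg (sq_nonneg _) (hv0 l))
    (fun m w => Finset.sum_le_sum fun j _ => hrow m w j)
    (fun m => Finset.sum_nonneg fun j _ => mul_nonneg zero_le_two (le_min hκ0 (hρ0 _))) t
  rw [← (measurePreserving_swap_coin (Fin K) (Fin M)).lintegral_comp (by fun_prop)] at hH
  refine (le_of_eq ?_).trans (hH.trans (ENNReal.ofReal_le_ofReal (Real.exp_le_exp.2 ?_)))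
  · refine lintegral_congr fun u => ?_
    simp only [hg, integral_sum_mixedRow_sq, Fintype.sum_prod_type]
  · have h1 : ∀ m, (∑ j, 2 * min κ (rowBound A B α (m, j))) ^ 2 ≤
        8 * (κ * ∑ j, rowBound A B α (m, j)) := fun m => by
      have h2 : ∀ r, min κ (rowBound A B α r) ^ 2 ≤ κ * rowBound A B α r := fun r => by
        rw [sq]
        exact mul_le_mul (min_le_left _ _) (min_le_right _ _) (le_min hκ0 (hρ0 _)) hκ0
      rw [Fin.sum_univ_two, Fin.sum_univ_two]
      have := h2 (m, 0)
      have := h2 (m, 1)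
      nlinarith [sq_nonneg (min κ (rowBound A B α (m, 0)) - min κ (rowBound A B α (m, 1)))]
    have h3 : ∑ m, (∑ j, 2 * min κ (rowBound A B α (m, j))) ^ 2 ≤
        8 * (κ * (α * frobNorm A + frobNorm B) ^ 2) := by
      refine (Finset.sum_le_sum fun m _ => h1 m).trans ?_
      rw [← Finset.mul_sum, ← Finset.mul_sum]
      have h4 := sum_rowBound_le A B hα
      rw [Fintype.sum_prod_type] at h4
      exact mul_le_mul_of_nonneg_left (mul_le_mul_of_nonneg_left h4 hκ0) (by norm_num)
    nlinarith [mul_le_mul_of_nonneg_left h3 (sq_nonneg t)]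

variable {Ω : Type*} [MeasurableSpace Ω] {μ : Measure Ω} {X : Fin n → Ω → ℝ}

/-- The received energy `∑ |Y(m)|²` when the source takes the values `X l` and transmitter `k`
sends `c k` with the signs `u k`. -/
def energy (A : Matrix (FadingIdx K M) (Fin n) ℝ) (B : Matrix (NoiseIdx M) (Fin n) ℝ)
    (c : Fin K → ℝ) (X : Fin n → Ω → ℝ) (ω : Ω) (u : Fin K → Fin M → Bool) : ℝ :=
  ∑ r, (∑ l, mixedRow A B c (fun k => u k r.1) r l * X l ω) ^ 2

theorem measurable_energy (A : Matrix (FadingIdx K M) (Fin n) ℝ)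
    (B : Matrix (NoiseIdx M) (Fin n) ℝ) (c : Fin K → ℝ) (hm : ∀ i, Measurable (X i)) :
    Measurable fun p : Ω × (Fin K → Fin M → Bool) => energy A B c X p.1 p.2 := by
  refine measurable_from_prod_countable_left fun u => ?_
  simp only [energy]
  fun_prop

/-- The moment generating function of the received energy: given the signs, the Hanson–Wright bound
controls the deviation from the conditional mean, and the conditional mean deviates from the mean as
in `lintegral_exp_condMean_le`. -/
theorem lintegral_exp_energy_le [IsProbabilityMeasure μ] (hX : ∀ i, HasSubgaussianMGF (X i) 1 μ)
    (hm : ∀ i, Measurable (X i)) (hind : iIndepFun X μ) (A : Matrix (FadingIdx K M) (Fin n) ℝ)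
    (B : Matrix (NoiseIdx M) (Fin n) ℝ) {c : Fin K → ℝ} {α : ℝ} (hα : 0 ≤ α)
    (hc : ∑ k, c k ^ 2 ≤ α ^ 2) {t : ℝ} (ht : |t| * (α * opNorm A + opNorm B) ^ 2 ≤ 1 / 64) :
    ∫⁻ p : Ω × (Fin K → Fin M → Bool), ENNReal.ofReal (Real.exp (t * (energy A B c X p.1 p.2 -
        ∑ r, ∑ l, (∑ k, (c k * A (r.1, r.2, k) l) ^ 2 + B r l ^ 2) * ∫ ω, X l ω ^ 2 ∂μ)))
        ∂μ.prod (Measure.pi fun _ => Measure.pi fun _ => coin) ≤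
      ENNReal.ofReal (Real.exp (43 * t ^ 2 *
        ((α * opNorm A + opNorm B) ^ 2 * (α * frobNorm A + frobNorm B) ^ 2))) := by
  have hE := measurable_energy A B c hm
  have hU := lintegral_exp_condMean_le A B hα hc (v := fun l => ∫ ω, X l ω ^ 2 ∂μ)
    (fun l => integral_nonneg fun ω => sq_nonneg _) (fun l => integral_sq_le (hX l) (hm l)) t
  set κ := (α * opNorm A + opNorm B) ^ 2
  set ψ := (α * frobNorm A + frobNorm B) ^ 2
  set e := ∑ r, ∑ l, (∑ k, (c k * A (r.1, r.2, k) l) ^ 2 + B r l ^ 2) * ∫ ω, X l ω ^ 2 ∂μ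
  rw [lintegral_prod_symm' _ (by fun_prop)]
  have hstep : ∀ u : Fin K → Fin M → Bool,
      ∫⁻ ω, ENNReal.ofReal (Real.exp (t * (energy A B c X ω u - e))) ∂μ ≤
      ENNReal.ofReal (Real.exp (42 * t ^ 2 * (κ * ψ))) * ENNReal.ofReal (Real.exp (t *
        (∑ r, ∑ l, mixedRow A B c (fun k => u k r.1) r l ^ 2 * ∫ ω, X l ω ^ 2 ∂μ - e))) := by
    intro u
    have hW := lintegral_exp_gram_le hX hm hind
      (fun (r : NoiseIdx M) l => mixedRow A B c (fun k => u k r.1) r l)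
      (sum_mixedRow_mul_sq_le A B hα hc fun m k => u k m) ht
    have h1 : ∀ ω, ENNReal.ofReal (Real.exp (t * (energy A B c X ω u - e))) =
        ENNReal.ofReal (Real.exp (t * (energy A B c X ω u -
          ∑ r, ∑ l, mixedRow A B c (fun k => u k r.1) r l ^ 2 * ∫ ω, X l ω ^ 2 ∂μ))) *
        ENNReal.ofReal (Real.exp (t *
          (∑ r, ∑ l, mixedRow A B c (fun k => u k r.1) r l ^ 2 * ∫ ω, X l ω ^ 2 ∂μ - e))) := by
      intro ω
      rw [← ENNReal.ofReal_mul (Real.exp_pos _).le, ← Real.exp_add]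
      congr 2; ring
    simp_rw [h1]
    rw [lintegral_mul_const _ (by unfold energy; fun_prop)]
    refine mul_le_mul_left (hW.trans (ENNReal.ofReal_le_ofReal (Real.exp_le_exp.2 ?_))) _
    have h2 : ∑ r, ∑ l, mixedRow A B c (fun k => u k r.1) r l ^ 2 ≤ ψ :=
      (Finset.sum_le_sum fun r _ => sum_mixedRow_sq_le_rowBound A B hα hc _ r).trans
        (sum_rowBound_le A B hα)
    have h3 : 0 ≤ κ := sq_nonneg _
    gcongr
  refine (lintegral_mono hstep).trans ?_
  rw [lintegral_const_mul _ (measurable_of_finite _)]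
  refine (mul_le_mul_right hU _).trans (le_of_eq ?_)
  rw [← ENNReal.ofReal_mul (Real.exp_pos _).le, ← Real.exp_add]
  congr 2; ring

/-- The two-sided Chernoff bound. -/
theorem measure_le_abs_le_of_lintegral_exp_le {Z : Ω → ℝ} (hZ : Measurable Z) {a t : ℝ}
    (ht : 0 < t) (hpos : ∫⁻ ω, ENNReal.ofReal (Real.exp (t * Z ω)) ∂μ ≤
      ENNReal.ofReal (Real.exp a))
    (hneg : ∫⁻ ω, ENNReal.ofReal (Real.exp (-t * Z ω)) ∂μ ≤ ENNReal.ofReal (Real.exp a)) (s : ℝ) :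
    μ {ω | s ≤ |Z ω|} ≤ ENNReal.ofReal (2 * Real.exp (a - t * s)) := by
  have key : ∀ W : Ω → ℝ, Measurable W →
      ∫⁻ ω, ENNReal.ofReal (Real.exp (t * W ω)) ∂μ ≤ ENNReal.ofReal (Real.exp a) →
      μ {ω | s ≤ W ω} ≤ ENNReal.ofReal (Real.exp (a - t * s)) := by
    intro W hW h
    have h1 := mul_meas_ge_le_lintegral (μ := μ)
      (f := fun ω => ENNReal.ofReal (Real.exp (t * W ω))) (by fun_prop)
      (ENNReal.ofReal (Real.exp (t * s)))
    have h2 : {ω | s ≤ W ω} ⊆ {ω | ENNReal.ofReal (Real.exp (t * s)) ≤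
        ENNReal.ofReal (Real.exp (t * W ω))} := fun ω hω =>
      ENNReal.ofReal_le_ofReal (Real.exp_le_exp.2 (mul_le_mul_of_nonneg_left hω ht.le))
    rw [Real.exp_sub, ENNReal.ofReal_div_of_pos (Real.exp_pos _),
      ENNReal.le_div_iff_mul_le (Or.inl (by simpa using Real.exp_pos _))
        (Or.inl ENNReal.ofReal_ne_top), mul_comm]
    exact (mul_le_mul_right (measure_mono h2) _).trans (h1.trans h)
  have hsub : {ω | s ≤ |Z ω|} ⊆ {ω | s ≤ Z ω} ∪ {ω | s ≤ -Z ω} := fun ω hω =>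
    show s ≤ Z ω ∨ s ≤ -Z ω from le_abs.1 hω
  refine (measure_mono hsub).trans ((measure_union_le _ _).trans ?_)
  rw [two_mul, ENNReal.ofReal_add (Real.exp_pos _).le (Real.exp_pos _).le]
  refine add_le_add (key _ hZ hpos) (key _ hZ.neg ?_)
  simpa using hneg

end Energy
end OTA

/-! ### The channel in terms of centered source variables -/

namespace OTA

section Centering

/-- The infimum in the sub-Gaussian norm need not be attained a priori; the bound for `t = 1` is the
limit of those for `t > 1`. -/
theorem hasSubgaussianMGF_of_subGaussianNorm_le {Ω : Type*} [MeasurableSpace Ω] {μ : Measure Ω}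
    {X : Ω → ℝ} (h : subGaussianNorm X μ ≤ 1) :
    HasSubgaussianMGF (fun ω => X ω - ∫ ω', X ω' ∂μ) 1 μ := by
  have key : ∀ a : ℝ, 1 < a → ∃ t : ℝ≥0, (t : ℝ) < a ∧
      HasSubgaussianMGF (fun ω => X ω - ∫ ω', X ω' ∂μ) (t ^ 2) μ := fun a ha => by
    have h1 : subGaussianNorm X μ < ENNReal.ofReal a :=
      h.trans_lt (by simpa using ha)
    simp only [subGaussianNorm, iInf_lt_iff] at h1
    obtain ⟨t, -, h2, h3⟩ := h1
    exact ⟨t, by rwa [ENNReal.lt_ofReal_iff_toReal_lt ENNReal.coe_ne_top] at h3, h2⟩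
  refine ⟨fun s => ?_, fun s => ?_⟩
  · obtain ⟨t, -, ht⟩ := key 2 (by norm_num)
    exact ht.integrable_exp_mul s
  · have hlim : Filter.Tendsto (fun a : ℝ => Real.exp (a ^ 2 * s ^ 2 / 2))
        (nhdsWithin 1 (Set.Ioi 1)) (nhds (Real.exp (((1 : ℝ≥0) : ℝ) * s ^ 2 / 2))) := by
      have : Continuous fun a : ℝ => Real.exp (a ^ 2 * s ^ 2 / 2) := by fun_prop
      simpa using (this.tendsto 1).mono_left nhdsWithin_le_nhds
    refine ge_of_tendsto hlim (eventually_nhdsWithin_of_forall fun a ha => ?_)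
    obtain ⟨t, hta, ht⟩ := key a ha
    refine (ht.mgf_le s).trans (Real.exp_le_exp.2 ?_)
    push_cast
    have := pow_le_pow_left₀ t.coe_nonneg hta.le 2
    have := mul_le_mul_of_nonneg_right this (sq_nonneg s)
    linarith

namespace Channel

variable {K M : ℕ} (C : Channel.{u} K M)

/-- The source variables with their means subtracted. -/
noncomputable def centered (l : SourceIdx K M) (ω : C.Ω) : ℝ := C.R l ω - ∫ ω', C.R l ω' ∂C.μ

/-- The second moments of the centered source variables. -/
noncomputable def secondMoment (l : SourceIdx K M) : ℝ := ∫ ω, C.centered l ω ^ 2 ∂C.μ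

theorem hasSubgaussianMGF_centered (l : SourceIdx K M) :
    HasSubgaussianMGF (C.centered l) 1 C.μ :=
  hasSubgaussianMGF_of_subGaussianNorm_le (C.subGaussian_R l)

theorem measurable_centered (l : SourceIdx K M) : Measurable (C.centered l) :=
  (C.measurable_R l).sub_const _

theorem iIndepFun_centered : iIndepFun C.centered C.μ :=
  C.indep_R.comp (fun l x => x - ∫ ω', C.R l ω' ∂C.μ) fun _ => measurable_id.sub_const _

theorem integrable_R (l : SourceIdx K M) : Integrable (C.R l) C.μ := by
  have := (C.hasSubgaussianMGF_centered l).integrable.add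
    (integrable_const (∫ ω', C.R l ω' ∂C.μ))
  refine this.congr (ae_of_all _ fun ω => ?_)
  simp [centered]

theorem integral_centered (l : SourceIdx K M) : ∫ ω, C.centered l ω ∂C.μ = 0 := by
  simp only [centered]
  rw [integral_sub (C.integrable_R l) (integrable_const _)]
  simp

/-- A linear image with mean zero does not see the means of the source variables. -/
theorem linImage_centered {ι : Type*} (A : Matrix ι (SourceIdx K M) ℝ) (i : ι)
    (h : ∫ ω, linImage A C.R i ω ∂C.μ = 0) (ω : C.Ω) :
    linImage A C.R i ω = ∑ l, A i l * C.centered l ω := by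
  simp only [linImage] at h
  rw [integral_finsetSum _ fun l _ => (C.integrable_R l).const_mul _] at h
  simp only [integral_const_mul] at h
  simp only [linImage, centered, mul_sub, Finset.sum_sub_distrib, h, sub_zero]

theorem sum_fading_sq_mul_secondMoment (i : FadingIdx K M) :
    ∑ l, C.A i l ^ 2 * C.secondMoment l = 1 := by
  have h1 := C.fading_variance i
  have h2 : linImage C.A C.R i = ∑ l, fun ω => C.A i l * C.centered l ω := by
    ext ω
    rw [C.linImage_centered C.A i (C.fading_mean i) ω, Finset.sum_apply]
  have hmem : ∀ l, MemLp (fun ω => C.A i l * C.centered l ω) 2 C.μ := fun l => by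
    simpa using ((C.hasSubgaussianMGF_centered l).memLp 2).const_mul (C.A i l)
  rw [h2, IndepFun.variance_sum (fun l _ => hmem l)] at h1
  · rw [← h1]
    refine Finset.sum_congr rfl fun l _ => ?_
    rw [variance_const_mul, variance_of_integral_eq_zero
      (C.measurable_centered l).aemeasurable (C.integral_centered l)]
    rfl
  · intro l _ l' _ hll'
    exact (C.iIndepFun_centered.indepFun hll').comp (φ := fun x => C.A i l * x)
      (ψ := fun x => C.A i l' * x) (by fun_prop) (by fun_prop)

theorem half_le_sum_fading_sq (i : FadingIdx K M) : 1 / 2 ≤ ∑ l, C.A i l ^ 2 := by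
  have h1 := C.sum_fading_sq_mul_secondMoment i
  have h2 : ∑ l, C.A i l ^ 2 * C.secondMoment l ≤ ∑ l, C.A i l ^ 2 * 2 :=
    Finset.sum_le_sum fun l _ => mul_le_mul_of_nonneg_left
      (integral_sq_le (C.hasSubgaussianMGF_centered l) (C.measurable_centered l)) (sq_nonneg _)
  rw [← Finset.sum_mul] at h2
  linarith

theorem le_frobNorm_fading_sq : (K * M : ℝ) ≤ frobNorm C.A ^ 2 := by
  rw [frobNorm_sq]
  have h := Finset.sum_le_sum fun i (_ : i ∈ Finset.univ) => C.half_le_sum_fading_sq i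
  simp only [Finset.sum_const, Finset.card_univ, Fintype.card_prod, Fintype.card_fin,
    nsmul_eq_mul] at h
  push_cast at h
  linarith

theorem half_le_opNorm_fading_sq (i : FadingIdx K M) : 1 / 2 ≤ opNorm C.A ^ 2 :=
  (C.half_le_sum_fading_sq i).trans
    (sum_row_sq_le C.A (sum_mulVec_sq_le_opNorm C.A) (sq_nonneg _) i)

/-- The mean energy of the noise. -/
noncomputable def noiseEnergy : ℝ := ∑ r, ∑ l, C.B r l ^ 2 * C.secondMoment l

theorem mean_energy (c : Fin K → ℝ) :
    ∑ r, ∑ l, (∑ k, (c k * C.A (r.1, r.2, k) l) ^ 2 + C.B r l ^ 2) *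
      ∫ ω, C.centered l ω ^ 2 ∂C.μ = 2 * M * ∑ k, c k ^ 2 + C.noiseEnergy := by
  have h : ∀ r : NoiseIdx M, ∑ l, (∑ k, (c k * C.A (r.1, r.2, k) l) ^ 2 + C.B r l ^ 2) *
      ∫ ω, C.centered l ω ^ 2 ∂C.μ =
      ∑ k, c k ^ 2 + ∑ l, C.B r l ^ 2 * C.secondMoment l := fun r => by
    simp only [add_mul, Finset.sum_add_distrib, Finset.sum_mul, mul_pow]
    congr 1
    rw [Finset.sum_comm]
    refine Finset.sum_congr rfl fun k _ => ?_
    have := C.sum_fading_sq_mul_secondMoment (r.1, r.2, k)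
    simp only [mul_assoc]
    rw [← Finset.mul_sum]
    simp only [secondMoment] at this
    rw [this, mul_one]
  rw [Finset.sum_congr rfl fun r _ => h r, Finset.sum_add_distrib, noiseEnergy]
  simp only [Finset.sum_const, Finset.card_univ, Fintype.card_prod, Fintype.card_fin,
    nsmul_eq_mul]
  push_cast; ring

theorem sum_norm_output_sq (c : Fin K → ℝ) (u : Fin K → Fin M → Bool) (ω : C.Ω) :
    ∑ m, ‖C.output (fun k m => ((c k * sign (u k m) : ℝ) : ℂ)) ω m‖ ^ 2 =
      energy C.A C.B c C.centered ω u := by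
  simp only [energy, sum_mixedRow_mul, Fintype.sum_prod_type]
  refine Finset.sum_congr rfl fun m _ => ?_
  rw [Complex.sq_norm, Complex.normSq_apply, Fin.sum_univ_two]
  simp only [output, Complex.add_re, Complex.add_im, Complex.re_sum, Complex.im_sum,
    Complex.re_mul_ofReal, Complex.im_mul_ofReal, H, N,
    C.linImage_centered C.A _ (C.fading_mean _), C.linImage_centered C.B _ (C.noise_mean _), ← sq]
  simp only [mul_comm]

end Channel
end Centering
end OTA

/-! ### The approximation scheme -/

namespace OTA

/-- A measurable selection of points of `D` at distance less than `t / 2`, wherever `D` has such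
points; the selected point is less than `t` away from every other such point. -/
theorem exists_measurable_nearPoint {D : Set ℝ} (hD : D.Nonempty) (t : ℝ) :
    ∃ p : ℝ → D, Measurable p ∧ ∀ (x : ℝ) (y : D), |x - y| < t / 2 → |(p x : ℝ) - y| < t := by
  classical
  have : Nonempty D := hD.to_subtype
  set d := TopologicalSpace.denseSeq D
  -- the second alternative makes the search terminate where `D` is far away
  have hex : ∀ x : ℝ, ∃ n, |x - d n| < t / 2 ∨ ∀ k, ¬ |x - d k| < t / 2 := fun x => by
    by_cases h : ∃ n, |x - d n| < t / 2
    · exact h.imp fun n hn => Or.inl hn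
    · exact ⟨0, Or.inr (not_exists.1 h)⟩
  have hmeas : ∀ n, MeasurableSet {x : ℝ | |x - d n| < t / 2} := fun n =>
    measurableSet_lt (by fun_prop) measurable_const
  refine ⟨fun x => d (Nat.find (hex x)), ?_, fun x y hxy => ?_⟩
  · refine (measurable_from_nat (f := d)).comp (measurable_find hex fun n => ?_)
    have h : MeasurableSet {x : ℝ | ∀ k, ¬ |x - d k| < t / 2} := by
      rw [Set.ofPred_forall]
      exact MeasurableSet.iInter fun k => (hmeas k).compl
    exact (hmeas n).union h
  · have hopen : IsOpen {z : D | |x - z| < t / 2} :=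
      isOpen_lt (by fun_prop) continuous_const
    obtain ⟨n, hn⟩ := (TopologicalSpace.denseRange_denseSeq D).exists_mem_open hopen ⟨y, hxy⟩
    have h := (Nat.find_spec (hex x)).resolve_right fun h => h n hn
    rw [abs_sub_comm] at h
    calc _ ≤ |(d (Nat.find (hex x)) : ℝ) - x| + |x - y| := abs_sub_le _ _ _
      _ < t := by linarith

namespace MonRep

variable {K M : ℕ} {S : Fin K → Set ℝ} {f : (∀ k, S k) → ℝ} (r : MonRep f)

theorem bddAbove_inner (k : Fin K) : BddAbove (Set.range (r.inner k)) := by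
  obtain ⟨b, hb⟩ := r.bounded_inner k
  exact ⟨b, by rintro _ ⟨s, rfl⟩; exact (abs_le.1 (hb s)).2⟩

theorem bddBelow_inner (k : Fin K) : BddBelow (Set.range (r.inner k)) := by
  obtain ⟨b, hb⟩ := r.bounded_inner k
  exact ⟨-b, by rintro _ ⟨s, rfl⟩; exact (abs_le.1 (hb s)).1⟩

/-- The excess of `f_k` over its infimum. -/
noncomputable def excess (k : Fin K) (s : S k) : ℝ := r.inner k s - ⨅ s, r.inner k s

theorem excess_nonneg (k : Fin K) (s : S k) : 0 ≤ r.excess k s :=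
  sub_nonneg.2 (ciInf_le (r.bddBelow_inner k) s)

theorem excess_le_spread (k : Fin K) (s : S k) : r.excess k s ≤ r.spread k :=
  sub_le_sub_right (le_ciSup (r.bddAbove_inner k) s) _

theorem sum_excess_le (s : ∀ k, S k) : ∑ k, r.excess k (s k) ≤ r.totalSpread :=
  Finset.sum_le_sum fun k _ => r.excess_le_spread k (s k)

theorem sum_inner_eq (s : ∀ k, S k) :
    ∑ k, r.inner k (s k) = ∑ k, r.excess k (s k) + ∑ k, ⨅ s, r.inner k s := by
  simp only [excess, Finset.sum_sub_distrib, sub_add_cancel]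

theorem spread_le_maxSpread (k : Fin K) : r.spread k ≤ r.maxSpread :=
  le_ciSup (Set.finite_range r.spread).bddAbove k

theorem maxSpread_pos (h : 0 < r.totalSpread) : 0 < r.maxSpread := by
  obtain ⟨k, -, hk⟩ := Finset.exists_lt_of_sum_lt (s := Finset.univ) (f := fun _ : Fin K => (0 : ℝ))
    (g := r.spread) (by simpa [totalSpread] using h)
  exact hk.trans_le (r.spread_le_maxSpread k)

theorem ΦInv_spec {ε : ℝ} (hεΦ : ε ∈ r.Φ '' Set.Ici 0) (hε : 0 < ε) :
    0 < r.ΦInv ε ∧ r.Φ (r.ΦInv ε) = ε := by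
  have h1 : r.ΦInv ε ∈ Set.Ici (0 : ℝ) := Function.invFunOn_mem hεΦ
  have h2 : r.Φ (r.ΦInv ε) = ε := Function.invFunOn_eq hεΦ
  refine ⟨lt_of_le_of_ne h1 fun h => ?_, h2⟩
  rw [← h, r.Φ_zero] at h2
  exact hε.ne h2

theorem abs_F_sub_lt {ε t : ℝ} (ht : r.Φ t = ε) (x y : r.D) (h : |(x : ℝ) - y| < t) :
    |r.F x - r.F y| < ε := by
  refine (r.majorant x y).trans_lt ?_
  rw [← ht]
  exact r.strictMono_Φ (Set.mem_Ici.2 (abs_nonneg _)) (Set.mem_Ici.2 ((abs_nonneg _).trans h.le)) h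

/-- If the inner sum varies by less than `Φ⁻¹(ε)`, then a constant estimate is good enough. -/
theorem isApproximated_of_totalSpread_lt (hne : ∀ k, (S k).Nonempty) {P : ℝ} (hP : 0 < P)
    {ε t : ℝ} (ht : r.Φ t = ε) (h : r.totalSpread < t) (C : Channel.{u} K M) (δ : ℝ) :
    IsApproximated C P f ε δ := by
  let s₀ : ∀ k, S k := fun k => ⟨(hne k).some, (hne k).some_mem⟩
  refine ⟨{ T := fun _ _ => Unit
            law := fun _ => Measure.dirac fun _ => ()
            enc := fun _ _ _ _ => 0
            measurable_enc := fun _ => measurable_const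
            power := fun _ _ _ _ => by simpa using hP.le
            dec := fun _ => f s₀
            measurable_dec := measurable_const }, fun s => ?_⟩
  have hlt : |f s₀ - f s| < ε := by
    rw [r.eq, r.eq]
    refine r.abs_F_sub_lt ht _ _ ?_
    simp only [r.sum_inner_eq, add_sub_add_right_eq_sub]
    have h1 := r.sum_excess_le s
    have h2 := r.sum_excess_le s₀
    have h3 : 0 ≤ ∑ k, r.excess k (s k) := Finset.sum_nonneg fun k _ => r.excess_nonneg k _
    have h4 : 0 ≤ ∑ k, r.excess k (s₀ k) := Finset.sum_nonneg fun k _ => r.excess_nonneg k _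
    rw [abs_lt]
    constructor <;> linarith
  simp [Scheme.errorProb, Scheme.estimate, not_le.2 hlt]

section Scheme

/-- The amplitude with which transmitter `k` sends the value `s`: the transmit power is
proportional to the excess of `f_k(s)`, and at most `P`. -/
noncomputable def amplitude (P : ℝ) (k : Fin K) (s : S k) : ℝ :=
  Real.sqrt (P / r.maxSpread * r.excess k s)

/-- The estimate of the inner sum from the received energy. -/
noncomputable def innerEstimate (C : Channel.{u} K M) (P : ℝ) (y : Fin M → ℂ) : ℝ :=
  r.maxSpread / (2 * M * P) * (∑ m, ‖y m‖ ^ 2 - C.noiseEnergy) + ∑ k, ⨅ s, r.inner k s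

theorem amplitude_sq {P : ℝ} (hP : 0 < P) (hΔ : 0 < r.maxSpread) (k : Fin K) (s : S k) :
    r.amplitude P k s ^ 2 = P / r.maxSpread * r.excess k s :=
  Real.sq_sqrt (mul_nonneg (by positivity) (r.excess_nonneg k s))

/-- Transmitter `k` modulates independent fair signs with `amplitude`; the receiver moves
`innerEstimate` to a point of the domain of `F` and applies `F`. -/
noncomputable def energyScheme {P : ℝ} (hP : 0 < P) (hΔ : 0 < r.maxSpread) (C : Channel.{u} K M)
    {p : ℝ → r.D} (hp : Measurable p) : Scheme S P M where
  T _ _ := Bool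
  law _ := Measure.pi fun _ => coin
  enc k _ s b := ((r.amplitude P k s * sign b : ℝ) : ℂ)
  measurable_enc k := by
    have h1 : Measurable (r.amplitude P k) := by
      unfold amplitude excess
      have := r.measurable_inner k
      fun_prop
    have h2 : Measurable sign := measurable_of_finite _
    fun_prop
  power k m s b := by
    rw [Complex.norm_real, Real.norm_eq_abs, sq_abs, mul_pow, sign_sq, mul_one,
      r.amplitude_sq hP hΔ]
    calc P / r.maxSpread * r.excess k s ≤ P / r.maxSpread * r.maxSpread := by
          refine mul_le_mul_of_nonneg_left ?_ (by positivity)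
          exact (r.excess_le_spread k s).trans (r.spread_le_maxSpread k)
      _ = P := by field_simp
  dec y := r.F (p (r.innerEstimate C P y))
  measurable_dec := by
    refine r.measurable_F.comp (hp.comp ?_)
    unfold innerEstimate
    fun_prop

end Scheme

section Bounds

variable (C : Channel.{u} K M) {P : ℝ}

theorem boundL_eq (hP : 0 < P) (hΔ : 0 < r.maxSpread) :
    r.boundL C P = r.maxSpread / P *
      (Real.sqrt (P * r.totalSpread / r.maxSpread) * opNorm C.A + opNorm C.B) ^ 2 := by
  have h : Real.sqrt r.totalSpread =
      Real.sqrt (r.maxSpread / P) * Real.sqrt (P * r.totalSpread / r.maxSpread) := by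
    rw [← Real.sqrt_mul (by positivity)]; congr 1; field_simp
  have h2 : Real.sqrt (r.maxSpread / P) ^ 2 = r.maxSpread / P := Real.sq_sqrt (by positivity)
  rw [boundL, h, mul_assoc, ← mul_add, mul_pow, h2]

theorem boundF_eq (hP : 0 < P) (hΔ : 0 < r.maxSpread) (hM : 1 ≤ M) :
    r.boundF C P = r.boundL C P * (r.maxSpread / (P * M) *
      (Real.sqrt (P * r.totalSpread / r.maxSpread) * frobNorm C.A + frobNorm C.B) ^ 2) := by
  have hM' : (0 : ℝ) < M := by exact_mod_cast hM
  have h : Real.sqrt (r.totalSpread / M) =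
      Real.sqrt (r.maxSpread / (P * M)) * Real.sqrt (P * r.totalSpread / r.maxSpread) := by
    rw [← Real.sqrt_mul (by positivity)]; congr 1; field_simp
  have h2 : Real.sqrt (r.maxSpread / (P * M)) ^ 2 = r.maxSpread / (P * M) :=
    Real.sq_sqrt (by positivity)
  rw [boundF, h, mul_assoc, ← mul_add, mul_pow, h2]

theorem boundL_nonneg : 0 ≤ r.boundL C P := sq_nonneg _

theorem totalSpread_mul_opNorm_sq_le_boundL (h0 : 0 ≤ r.totalSpread) :
    r.totalSpread * opNorm C.A ^ 2 ≤ r.boundL C P := by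
  have h1 : r.totalSpread * opNorm C.A ^ 2 = (Real.sqrt r.totalSpread * opNorm C.A) ^ 2 := by
    rw [mul_pow, Real.sq_sqrt h0]
  rw [h1, boundL]
  have := opNorm_nonneg C.A
  have := opNorm_nonneg C.B
  exact pow_le_pow_left₀ (by positivity) (le_add_of_nonneg_right (by positivity)) 2

theorem boundL_mul_totalSpread_le_boundF (hK : 0 < K) (hM : 1 ≤ M) (h0 : 0 ≤ r.totalSpread) :
    r.boundL C P * r.totalSpread ≤ r.boundF C P := by
  refine mul_le_mul_of_nonneg_left ?_ (r.boundL_nonneg C)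
  have hM' : (0 : ℝ) < M := by exact_mod_cast hM
  have hK' : (1 : ℝ) ≤ K := by exact_mod_cast hK
  have := frobNorm_nonneg C.A
  have := frobNorm_nonneg C.B
  calc r.totalSpread = r.totalSpread / M * (1 * M) := by field_simp
    _ ≤ r.totalSpread / M * frobNorm C.A ^ 2 :=
        mul_le_mul_of_nonneg_left ((mul_le_mul_of_nonneg_right hK' hM'.le).trans
          C.le_frobNorm_fading_sq) (by positivity)
    _ = (Real.sqrt (r.totalSpread / M) * frobNorm C.A) ^ 2 := by
        rw [mul_pow, Real.sq_sqrt (by positivity)]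
    _ ≤ _ := pow_le_pow_left₀ (by positivity) (le_add_of_nonneg_right (by positivity)) 2

theorem half_totalSpread_le_boundL (hK : 0 < K) (hM : 1 ≤ M) (h0 : 0 ≤ r.totalSpread) :
    r.totalSpread / 2 ≤ r.boundL C P := by
  have h1 := C.half_le_opNorm_fading_sq (⟨0, hM⟩, 0, ⟨0, hK⟩)
  have h2 := r.totalSpread_mul_opNorm_sq_le_boundL (P := P) C h0
  nlinarith

theorem le_Gam (η ε : ℝ) :
    256 * r.boundF C P + 32 * r.ΦInv ε * r.boundL C P ≤ r.Gam C P η ε := le_max_right _ _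

end Bounds

/-- The Chernoff bound for the received energy. As `t` is at most the total spread, the optimal
exponent lies in the range where the Hanson–Wright bound applies. -/
theorem measure_energy_sub_mean_le (hK : 0 < K) (hM : 1 ≤ M) {P : ℝ} (hP : 0 < P)
    {t δ : ℝ} (hδ : 0 < δ) (ht : 0 < t) (htΔ : t ≤ r.totalSpread) (C : Channel.{u} K M)
    (hMt : (Real.log 4 - Real.log δ) * (200 * r.boundF C P) ≤ M * t ^ 2)
    {c : Fin K → ℝ} (hc : ∑ k, c k ^ 2 ≤ P * r.totalSpread / r.maxSpread) :
    (C.μ.prod (Measure.pi fun _ : Fin K => Measure.pi fun _ : Fin M => coin))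
      {p | M * P * t / r.maxSpread ≤ |energy C.A C.B c C.centered p.1 p.2 -
        (2 * M * ∑ k, c k ^ 2 + C.noiseEnergy)|} ≤ ENNReal.ofReal δ := by
  have h0 : 0 < r.totalSpread := ht.trans_le htΔ
  have hΔ := r.maxSpread_pos h0
  have hM' : (0 : ℝ) < M := by exact_mod_cast hM
  set Δ := r.maxSpread with hΔdef
  set α := Real.sqrt (P * r.totalSpread / Δ) with hα
  have hα0 : 0 ≤ α := Real.sqrt_nonneg _
  have hcα : ∑ k, c k ^ 2 ≤ α ^ 2 := by rwa [hα, Real.sq_sqrt (by positivity)]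
  have hL := r.boundL_eq C hP hΔ
  have hF := r.boundF_eq C hP hΔ hM
  rw [← hΔdef, ← hα] at hL hF
  have hLpos : 0 < r.boundL C P :=
    (by positivity : 0 < r.totalSpread / 2).trans_le (r.half_totalSpread_le_boundL C hK hM h0.le)
  have hLF : r.boundL C P * t ≤ r.boundF C P :=
    (mul_le_mul_of_nonneg_left htΔ hLpos.le).trans
      (r.boundL_mul_totalSpread_le_boundF C hK hM h0.le)
  have hFpos : 0 < r.boundF C P := (mul_pos hLpos ht).trans_le hLF
  set κ := (α * opNorm C.A + opNorm C.B) ^ 2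
  set ψ := (α * frobNorm C.A + frobNorm C.B) ^ 2
  set L := r.boundL C P
  set F := r.boundF C P
  have hκ : κ = P / Δ * L := by rw [hL]; field_simp
  have hκψ : κ * ψ = (P / Δ) ^ 2 * M * F := by rw [hF, hκ]; field_simp
  -- the minimizer of `50 τ² κ ψ - τ s` for the threshold `s = M P t / Δ`
  set τ := Δ * t / (100 * P * F) with hτ
  have hτ0 : 0 < τ := by positivity
  have hτκ : τ * κ ≤ 1 / 64 := by
    have h1 : τ * κ = L * t / (100 * F) := by rw [hτ, hκ]; field_simp
    rw [h1, div_le_div_iff₀ (by positivity) (by norm_num)]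
    linarith
  have hE := measurable_energy C.A C.B c C.measurable_centered
  have hpos := lintegral_exp_energy_le C.hasSubgaussianMGF_centered C.measurable_centered
    C.iIndepFun_centered C.A C.B hα0 hcα (t := τ) (by rwa [abs_of_pos hτ0])
  have hneg := lintegral_exp_energy_le C.hasSubgaussianMGF_centered C.measurable_centered
    C.iIndepFun_centered C.A C.B hα0 hcα (t := -τ) (by rwa [abs_neg, abs_of_pos hτ0])
  rw [C.mean_energy] at hpos hneg
  rw [neg_sq] at hneg
  refine (measure_le_abs_le_of_lintegral_exp_le (hE.sub_const _) hτ0 hpos hneg _).trans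
    (ENNReal.ofReal_le_ofReal ?_)
  have hexp : 43 * τ ^ 2 * (κ * ψ) - τ * (M * P * t / Δ) ≤ Real.log δ - Real.log 4 := by
    have h1 : τ ^ 2 * (κ * ψ) = M * t ^ 2 / (10000 * F) := by rw [hτ, hκψ]; field_simp; norm_num
    have h2 : τ * (M * P * t / Δ) = M * t ^ 2 / (100 * F) := by rw [hτ]; field_simp
    have h3 : Real.log 4 - Real.log δ ≤ M * t ^ 2 / (200 * F) := by
      rw [le_div_iff₀ (by positivity)]; exact hMt
    have h4 : M * t ^ 2 / (10000 * F) = M * t ^ 2 / (200 * F) / 50 := by field_simp; norm_num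
    have h5 : M * t ^ 2 / (100 * F) = 2 * (M * t ^ 2 / (200 * F)) := by field_simp; norm_num
    have h6 : 0 ≤ M * t ^ 2 / (200 * F) := by positivity
    rw [mul_assoc, h1, h2, h4, h5]
    linarith
  calc 2 * Real.exp (43 * τ ^ 2 * (κ * ψ) - τ * (M * P * t / Δ))
      ≤ 2 * Real.exp (Real.log δ - Real.log 4) := by gcongr
    _ = δ / 2 := by
        rw [Real.exp_sub, Real.exp_log hδ, Real.exp_log (by norm_num)]; ring
    _ ≤ δ := by linarith

/-- The constant `200` is smaller than the `256` in `Gam`: the margin pays for rounding the number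
of channel uses down. -/
theorem isApproximated_of_le_totalSpread (hK : 0 < K) (hM : 1 ≤ M) {P : ℝ} (hP : 0 < P)
    {ε t δ : ℝ} (hδ : 0 < δ) (ht : 0 < t) (htε : r.Φ t = ε)
    (hne : ∀ k, (S k).Nonempty) (htΔ : t ≤ r.totalSpread) (C : Channel.{u} K M)
    (hMt : (Real.log 4 - Real.log δ) * (200 * r.boundF C P) ≤ M * t ^ 2) :
    IsApproximated C P f ε δ := by
  have hΔ := r.maxSpread_pos (ht.trans_le htΔ)
  have hM' : (0 : ℝ) < M := by exact_mod_cast hM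
  obtain ⟨p, hp, hnear⟩ := exists_measurable_nearPoint
    (D := r.D) ⟨_, r.sum_mem fun k => ⟨(hne k).some, (hne k).some_mem⟩⟩ t
  refine ⟨r.energyScheme hP hΔ C hp, fun s => ?_⟩
  have hsum : ∑ k, r.amplitude P k (s k) ^ 2 =
      P / r.maxSpread * ∑ k, r.excess k (s k) := by
    simp only [r.amplitude_sq hP hΔ, Finset.mul_sum]
  refine le_trans (measure_mono ?_) (r.measure_energy_sub_mean_le hK hM hP hδ ht htΔ C hMt
    (c := fun k => r.amplitude P k (s k)) ?_)
  · intro q hq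
    change M * P * t / r.maxSpread ≤ |energy C.A C.B (fun k => r.amplitude P k (s k)) C.centered
      q.1 q.2 - (2 * M * ∑ k, r.amplitude P k (s k) ^ 2 + C.noiseEnergy)|
    by_contra! hlt
    rw [Set.mem_ofPred_eq] at hq
    refine absurd hq (not_le.2 ?_)
    rw [r.eq]
    refine r.abs_F_sub_lt htε _ _ (hnear _ _ ?_)
    rw [innerEstimate, show ∑ m, ‖C.output (fun k m =>
      (r.energyScheme hP hΔ C hp).enc k m (s k) (q.2 k m)) q.1 m‖ ^ 2 =
      energy C.A C.B (fun k => r.amplitude P k (s k)) C.centered q.1 q.2 from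
      C.sum_norm_output_sq _ _ _]
    rw [hsum] at hlt
    simp only [r.sum_inner_eq]
    have h1 : r.maxSpread / (2 * M * P) * (energy C.A C.B (fun k => r.amplitude P k (s k))
          C.centered q.1 q.2 - C.noiseEnergy) + ∑ k, (⨅ s, r.inner k s) -
          (∑ k, r.excess k (s k) + ∑ k, ⨅ s, r.inner k s) =
        r.maxSpread / (2 * M * P) * (energy C.A C.B (fun k => r.amplitude P k (s k))
          C.centered q.1 q.2 -
          (2 * M * (P / r.maxSpread * ∑ k, r.excess k (s k)) + C.noiseEnergy)) := by
      field_simp; ring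
    rw [h1, abs_mul, abs_of_pos (by positivity)]
    calc _ < r.maxSpread / (2 * M * P) * (M * P * t / r.maxSpread) :=
          mul_lt_mul_of_pos_left hlt (by positivity)
      _ = t / 2 := by field_simp
  · rw [hsum]
    calc _ ≤ P / r.maxSpread * r.totalSpread :=
          mul_le_mul_of_nonneg_left (r.sum_excess_le s) (by positivity)
      _ = _ := by ring

end MonRep

theorem commCost_le {K : ℕ} {S : Fin K → Set ℝ} {C : ∀ M, Channel.{u} K M} {P : ℝ}
    {f : (∀ k, S k) → ℝ} {ε δ : ℝ} {M : ℕ} (h : IsApproximated (C M) P f ε δ) :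
    commCost C P f ε δ ≤ M := iInf₂_le M h

end OTA

/-! ### The communication cost -/

theorem corollary1 {K : ℕ} (hK : 0 < K) {S : Fin K → Set ℝ}
    (hS : ∀ k, IsClosed (S k)) (hne : ∀ k, (S k).Nonempty)
    (f : (∀ k, S k) → ℝ) (r : OTA.MonRep f)
    (P : ℝ) (hP : 0 < P) (ε : ℝ) (hε : 0 < ε) (hεΦ : ε ∈ r.Φ '' Set.Ici 0)
    (δ : ℝ) (hδ : δ ∈ Set.Ioo (0 : ℝ) 1)
    (C : ∀ M : ℕ, OTA.Channel.{u} K M)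
    (Ai : ∀ M : ℕ, Matrix (OTA.FadingIdx K M) (OTA.SourceIdx K M) ℝ) (η : ℕ → ℝ)
    (hAi : ∀ M, (C M).GeneratesUserUncorrelated (Ai M))
    (hη : ∀ M, OTA.opNorm (((C M).A + Ai M) * ((C M).A - Ai M).transpose) ≤ η M) :
    (∀ M : ℕ, 1 ≤ M →
      (Real.log 4 - Real.log δ) / r.ΦInv ε ^ 2 * r.Gam (C M) P (η M) ε ≤ M →
        OTA.commCost C P f ε δ ≤ M) ∧
    (∀ G : ℝ, (∀ M : ℕ, 1 ≤ M → r.Gam (C M) P (η M) ε ≤ G) →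
      (OTA.commCost C P f ε δ : ENNReal) ≤
        ENNReal.ofReal ((Real.log 4 - Real.log δ) / r.ΦInv ε ^ 2 * G)) := by
  obtain ⟨ht, htε⟩ := r.ΦInv_spec hεΦ hε
  set t := r.ΦInv ε
  have hlog : 1 ≤ Real.log 4 - Real.log δ := by
    have h1 : Real.log δ < 0 := Real.log_neg hδ.1 hδ.2
    have h2 : 1 ≤ Real.log 4 := by
      rw [Real.le_log_iff_exp_le (by norm_num)]
      linarith [Real.exp_one_lt_d9]
    linarith
  set ℓ := Real.log 4 - Real.log δ
  by_cases htΔ : r.totalSpread < t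
  · have h0 : OTA.commCost C P f ε δ ≤ (0 : ℕ) :=
      OTA.commCost_le (r.isApproximated_of_totalSpread_lt hne hP htε htΔ _ δ)
    have h0' : OTA.commCost C P f ε δ = 0 := by simpa using h0
    rw [h0']
    simp
  push Not at htΔ
  have htot : 0 ≤ r.totalSpread := ht.le.trans htΔ
  have hF : ∀ M : ℕ, 1 ≤ M → 0 ≤ r.boundF (C M) P := fun M hM =>
    (mul_nonneg (r.boundL_nonneg _) htot).trans
      (r.boundL_mul_totalSpread_le_boundF (C M) hK hM htot)
  have hL : ∀ M : ℕ, 1 ≤ M → t / 2 ≤ r.boundL (C M) P := fun M hM =>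
    (by linarith : t / 2 ≤ r.totalSpread / 2).trans
      (r.half_totalSpread_le_boundL (C M) hK hM htot)
  constructor
  · intro M hM h
    refine OTA.commCost_le (r.isApproximated_of_le_totalSpread hK hM hP hδ.1 ht htε hne htΔ _ ?_)
    rw [div_mul_eq_mul_div, div_le_iff₀ (by positivity)] at h
    refine le_trans (mul_le_mul_of_nonneg_left ?_ (by linarith)) h
    refine le_trans ?_ (r.le_Gam (C M) (η M) ε)
    have := hF M hM
    have := mul_nonneg ht.le (r.boundL_nonneg (P := P) (C M))
    linarith
  · intro G hG
    set T := ℓ / t ^ 2 * G with hT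
    have hTt : T * t ^ 2 = ℓ * G := by rw [hT]; field_simp
    have hT16 : 16 ≤ T := by
      have h1 : 16 * t ^ 2 ≤ G := by
        refine le_trans ?_ ((r.le_Gam (P := P) (C 1) (η 1) ε).trans (hG 1 le_rfl))
        have := hF 1 le_rfl
        have := mul_le_mul_of_nonneg_left (hL 1 le_rfl) ht.le
        linarith
      have h2 : 16 * t ^ 2 ≤ T * t ^ 2 := by
        rw [hTt]
        have : 0 ≤ G := le_trans (by positivity) h1
        nlinarith
      exact le_of_mul_le_mul_right h2 (by positivity)
    set M := ⌊T⌋₊ with hMdef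
    have hM : 1 ≤ M := Nat.le_floor (by norm_num; linarith)
    have hMT : T - 1 < M := Nat.sub_one_lt_floor T
    -- `M ≥ T - 1 ≥ 15 T / 16`, and `15 / 16 ≥ 200 / 256`
    have happ : OTA.IsApproximated (C M) P f ε δ := by
      refine r.isApproximated_of_le_totalSpread hK hM hP hδ.1 ht htε hne htΔ _ ?_
      have h1 : 256 * r.boundF (C M) P ≤ G := by
        refine le_trans ?_ ((r.le_Gam (C M) (η M) ε).trans (hG M hM))
        have := mul_nonneg ht.le (r.boundL_nonneg (P := P) (C M))
        linarith
      calc ℓ * (200 * r.boundF (C M) P) ≤ ℓ * (200 / 256 * G) :=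
            mul_le_mul_of_nonneg_left (by linarith) (by linarith)
        _ = 200 / 256 * T * t ^ 2 := by rw [mul_assoc, hTt]; ring
        _ ≤ M * t ^ 2 := mul_le_mul_of_nonneg_right (by linarith) (sq_nonneg t)
    refine (ENat.toENNReal_le.2 (OTA.commCost_le happ)).trans ?_
    rw [ENat.toENNReal_coe, ← ENNReal.ofReal_natCast]
    exact ENNReal.ofReal_le_ofReal (Nat.floor_le (by linarith))
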